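/- **Setting.** Let $V$ (label nodes), $E$ (factors), $\mathcal S$ (training pairs $(x,y)$) and the set of feature indices $r$ be finite. Each node $v$ has a finite nonempty set $\mathcal Y_v$ of label values, each factor $\alpha\in E$ has a set $N(\alpha)\subseteq V$ of nodes, $N(v)=\{\alpha: v\in N(\alpha)\}$ and $\mathcal Y_\alpha=\prod_{v\in N(\alpha)}\mathcal Y_v$. Labels are $y=(y_v)_v$. For each $r$ and $x$ let $V_{r,x}\subseteq V$, $E_{r,x}\subseteq E$, and let $\phi_{r,v}(x,\cdot):\mathcal Y_v\to\mathbb R$, $\phi_{r,\alpha}(x,\cdot):\mathcal Y_\alpha\to\mathbb R$, $e_{y,v}:\mathcal Y_v\to\mathbb R$ be arbitrary. Put $d_r=\sum_{(x,y)\in\mathcal S}\big(\sum_{v\in V_{r,x}}\phi_{r,v}(x,y_v)+\sum_{\alpha\in E_{r,x}}\phi_{r,\alpha}(x,y_\alpha)\big)$. Let $C>0$, $p,q>1$ with $1/p+1/q=1$, and $\epsilon,c_\alpha,c_v\ge 0$. For $\tau>0$ let $\mathrm{smax}_\tau f=\tau\ln\sum_i e^{f_i/\tau}$, and $\mathrm{smax}_0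 f=\max_i f_i$. **Primal.** With $\phi_{x,y,v}=e_{y,v}+\sum_{r:v\in V_{r,x}}\theta_r\phi_{r,v}(x,\cdot)$ and $\phi_{x,y,\alpha}=\sum_{r:\alpha\in E_{r,x}}\theta_r\phi_{r,\alpha}(x,\cdot)$, put $g_{x,y,v}=\phi_{x,y,v}-\sum_{\alpha\in N(v)}\lambda_{x,y,v\to\alpha}$, $g_{x,y,\alpha}(\hat y_\alpha)=\phi_{x,y,\alpha}(\hat y_\alpha)+\sum_{v\in N(\alpha)}\lambda_{x,y,v\to\alpha}(\hat y_v)$. The approximated structured prediction objective is $$F(\lambda,\theta)=\sum_{(x,y),v}\mathrm{smax}_{\epsilon c_v}g_{x,y,v}+\sum_{(x,y),\alpha}\mathrm{smax}_{\epsilon c_\alpha}g_{x,y,\alpha}-\sum_r d_r\theta_r+\frac Cp\sum_r|\theta_r|^p .$$ **Dual.** For beliefs $b$ and $m_r(b)=\sum_{(x,y)}\big(\sum_{v\in V_{r,x},\hat y_v}b_{x,y,v}(\hat y_v)\phi_{r,v}(x,\hat y_v)+\sum_{\alpha\in E_{r,x},\hat y_\alpha}b_{x,y,\alpha}(\hat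 y_\alpha)\phi_{r,\alpha}(x,\hat y_\alpha)\big)$, the approximated dual is to maximize $$\sum_{(x,y)}\Big(\sum_\alpha\epsilon c_\alpha H(b_{x,y,\alpha})+\sum_v\epsilon c_vH(b_{x,y,v})+\sum_{v,\hat y_v}b_{x,y,v}(\hat y_v)e_{y,v}(\hat y_v)\Big)-\frac{C^{1-q}}q\sum_r|m_r(b)-d_r|^q$$ over probability distributions $b_{x,y,v}$ on $\mathcal Y_v$ and $b_{x,y,\alpha}$ on $\mathcal Y_\alpha$ such that $b_{x,y,v}$ is the marginal of $b_{x,y,\alpha}$ whenever $v\in N(\alpha)$; here $H(b)=-\sum b\ln b$. **Algorithm.** Start at arbitrary $(\lambda,\theta)$. The beliefs at $(\lambda,\theta)$ are $b_{x,y,v}\propto\exp(g_{x,y,v}/(\epsilon c_v))$ and $b_{x,y,\alpha}\propto\exp(g_{x,y,\alpha}/(\epsilon c_\alpha))$; where $\epsilon c_v=0$ (resp. $\epsilon c_\alpha=0$) any probability distribution supported on the maximizers of $g$ may be taken. At each step one block is updated, the blocks being chosen in some order: * *Messages at a node $v$*: for all $(x,y)$, $\alpha\in N(v)$, $\hat y_v$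 simultaneously, let $\mu_{x,y,\alpha\to v}(\hat y_v)$ be $\mathrm{smax}_{\epsilon c_\alpha}$, over all $\hat y_\alpha$ with $v$-coordinate $\hat y_v$, of $\phi_{x,y,\alpha}(\hat y_\alpha)+\sum_{u\in N(\alpha)\setminus v}\lambda_{x,y,u\to\alpha}(\hat y_u)$, and set $$\lambda_{x,y,v\to\alpha}\leftarrow\frac{w_\alpha}{\hat w_v}\Big(\phi_{x,y,v}+\sum_{\beta\in N(v)}\mu_{x,y,\beta\to v}\Big)-\mu_{x,y,\alpha\to v}+k_{x,y,v\to\alpha},\qquad \hat w_v=w_v+\sum_{\beta\in N(v)}w_\beta,$$ with arbitrary constants $k_{x,y,v\to\alpha}$. Here $w=c$ if $\epsilon(c_v+\sum_{\beta\in N(v)}c_\beta)>0$; otherwise $w_v,w_\alpha\ge0$ are arbitrary with $\hat w_v>0$. * *Parameter $\theta_r$*: $\theta_r\leftarrow\theta_r-\eta\,G_r$ with $G_r=m_r(b)-d_r+C|\theta_r|^{p-1}\mathrm{sign}(\theta_r)$, $b$ being the current beliefs and $\eta\ge0$ a step size for which $F$ does not increase. **Claim.** 1. In every run of the algorithm,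 with any order of the blocks, $F(\lambda^t,\theta^t)$ is nonincreasing in $t$ and converges to a real number. 2. Suppose $\epsilon>0$ and all $c_\alpha,c_v>0$. Then the dual objective is strictly concave on its feasible set, the dual has exactly one solution $b^*$, and $F$ attains its global minimum. Moreover, for every run such that (i) for some $T$ every block is updated at least once in any $T$ consecutive steps (e.g. cyclic sweeps over all $v$ and then all $r$), and (ii) the step sizes come from a line search, $F(\lambda^t,\theta^t)$ converges to $\min F$ and the beliefs $b^t$ at $(\lambda^t,\theta^t)$ converge to $b^*$. Condition (ii) means that for some fixed $\sigma,\beta\in(0,1)$ and $\eta_0>0$, each step size $\eta$ either minimizes $F$ over all step sizes $\eta\ge0$ in the direction $-G_r$ of $\theta_r$, or satisfies $\eta>0$, the sufficient decrease condition $F_{\rm new}\le F_{\rm old}-\sigma\eta G_r^2$, and: $\eta\ge\eta_0$ or the condition fails for some step size $\eta'\in(\eta,\eta/\beta]$. (Backtracking from $\eta_0$ by the factor $\beta$, and a constant step size below $2/L$ when $\partial F/\partial\theta_r$ is $L$-Lipschitz in $\theta_r$, are of the second kind.) -/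

import Mathlib

open Filter Topology

noncomputable section

namespace StructPred

/-! ### Soft-max, Gibbs distributions and entropy on a finite set -/

/-- The soft-max `τ ln ∑ exp (f / τ)` at temperature `τ > 0`, and `max f` at temperature `τ = 0`. -/
def softMax {ι : Type*} [Fintype ι] (τ : ℝ) (f : ι → ℝ) : ℝ :=
  if τ = 0 then ⨆ i, f i else τ * Real.log (∑ i, Real.exp (f i / τ))

/-- `b` is a belief for the potential `f` at temperature `τ`: the distribution `b ∝ exp (f / τ)`
when `τ ≠ 0`, and any probability distribution supported on the maximizers of `f` when `τ = 0`. -/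
def IsBelief {ι : Type*} [Fintype ι] (τ : ℝ) (f b : ι → ℝ) : Prop :=
  if τ = 0 then b ∈ stdSimplex ℝ ι ∧ ∀ i, 0 < b i → ∀ j, f j ≤ f i
  else ∀ i, b i = Real.exp (f i / τ) / ∑ j, Real.exp (f j / τ)

/-- The entropy `- ∑ b ln b`, with `0 ln 0 = 0`. -/
def entropy {ι : Type*} [Fintype ι] (b : ι → ℝ) : ℝ := ∑ i, Real.negMulLog (b i)

/-! ### The learning problem -/

/-- The data of a structured prediction problem. `V` is the set of label nodes, `A` the set of
factors, `R` indexes the features, `S` indexes the training pairs, `X` is the set of objects and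
`Y v` the set of values of the label `y_v`. -/
structure Problem (V A R S X : Type*) (Y : V → Type*) where
  /-- the set of label nodes of the factor `α`; it is also its neighbourhood `N(α)` -/
  scope : A → Finset V
  /-- the object `x` of a training pair -/
  input : S → X
  /-- the label `y` of a training pair -/
  label : S → (v : V) → Y v
  /-- the label nodes `V_{r,x}` of the factor graph of the feature `r` -/
  nodes : R → X → Finset V
  /-- the factors `E_{r,x}` of the factor graph of the feature `r` -/
  factors : R → X → Finset A
  /-- `φ_{r,v}(x, ŷ_v)` -/
  phiV : R → (v : V) → X → Y v → ℝ
  /-- `φ_{r,α}(x, ŷ_α)` -/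
  phiA : R → (α : A) → X → ((v : {v // v ∈ scope α}) → Y v) → ℝ
  /-- the prior `e_{y,v}(ŷ_v)` -/
  err : ((v : V) → Y v) → (v : V) → Y v → ℝ
  /-- the temperature `ε` -/
  eps : ℝ
  /-- the entropy weights `c_α` -/
  cA : A → ℝ
  /-- the entropy weights `c_v` -/
  cV : V → ℝ
  /-- the regularization constant `C` -/
  C : ℝ
  /-- the exponent `p` of the regularization -/
  p : ℝ

namespace Problem

variable {V A R S X : Type*} {Y : V → Type*}
  [Fintype V] [DecidableEq V] [Fintype A] [Fintype R] [DecidableEq R] [Fintype S]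
  [∀ v, Fintype (Y v)] [∀ v, DecidableEq (Y v)]
  (M : Problem V A R S X Y)

/-- The joint labels `ŷ_α` of the nodes of the factor `α`. -/
abbrev FactorLabel (α : A) : Type _ := (v : {v // v ∈ M.scope α}) → Y v

/-- The factors `N(v)` adjacent to the node `v`. -/
abbrev Nbr (v : V) : Type _ := {α : A // v ∈ M.scope α}

/-- The messages `λ_{x,y,v → α}(ŷ_v)`, one for every training pair, factor `α` and node
`v ∈ N(α)`. -/
abbrev Messages : Type _ := S → (α : A) → (v : {v // v ∈ M.scope α}) → Y v → ℝ

/-- The families of beliefs `(b_{x,y,v}, b_{x,y,α})`. -/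
abbrev Beliefs : Type _ :=
  (S → (v : V) → Y v → ℝ) × (S → (α : A) → M.FactorLabel α → ℝ)

/-- The empirical means `d_r = ∑_{(x,y)} φ_r(x, y)`. -/
def empirical (r : R) : ℝ :=
  ∑ s, (∑ v ∈ M.nodes r (M.input s), M.phiV r v (M.input s) (M.label s v)
    + ∑ α ∈ M.factors r (M.input s), M.phiA r α (M.input s) (fun v => M.label s v))

open scoped Classical in
/-- `e_{y,v}(ŷ_v) + ∑_{r : v ∈ V_{r,x}} θ_r φ_{r,v}(x, ŷ_v)` -/
def potV (θ : R → ℝ) (s : S) (v : V) (z : Y v) : ℝ :=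
  M.err (M.label s) v z
    + ∑ r, if v ∈ M.nodes r (M.input s) then θ r * M.phiV r v (M.input s) z else 0

open scoped Classical in
/-- `∑_{r : α ∈ E_{r,x}} θ_r φ_{r,α}(x, ŷ_α)` -/
def potA (θ : R → ℝ) (s : S) (α : A) (z : M.FactorLabel α) : ℝ :=
  ∑ r, if α ∈ M.factors r (M.input s) then θ r * M.phiA r α (M.input s) z else 0

/-- `e_{y,v}(ŷ_v) + ∑_{r : v ∈ V_{r,x}} θ_r φ_{r,v}(x, ŷ_v) - ∑_{α ∈ N(v)} λ_{x,y,v → α}(ŷ_v)` -/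
def reparV (lam : M.Messages) (θ : R → ℝ) (s : S) (v : V) (z : Y v) : ℝ :=
  M.potV θ s v z - ∑ α : M.Nbr v, lam s α.1 ⟨v, α.2⟩ z

/-- `∑_{r : α ∈ E_{r,x}} θ_r φ_{r,α}(x, ŷ_α) + ∑_{v ∈ N(α)} λ_{x,y,v → α}(ŷ_v)` -/
def reparA (lam : M.Messages) (θ : R → ℝ) (s : S) (α : A) (z : M.FactorLabel α) : ℝ :=
  M.potA θ s α z + ∑ v, lam s α v (z v)

/-- The objective of the approximated structured prediction program (the primal). -/
def objective (lam : M.Messages) (θ : R → ℝ) : ℝ :=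
  ∑ s, ∑ v, softMax (M.eps * M.cV v) (M.reparV lam θ s v)
    + ∑ s, ∑ α, softMax (M.eps * M.cA α) (M.reparA lam θ s α)
    - ∑ r, M.empirical r * θ r + M.C / M.p * ∑ r, |θ r| ^ M.p

/-! ### The approximated dual program -/

/-- The moment of the feature `r` under the beliefs `b`. -/
def moment (b : M.Beliefs) (r : R) : ℝ :=
  ∑ s, (∑ v ∈ M.nodes r (M.input s), ∑ z, b.1 s v z * M.phiV r v (M.input s) z
    + ∑ α ∈ M.factors r (M.input s), ∑ z, b.2 s α z * M.phiA r α (M.input s) z)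

/-- The objective of the approximated dual; `q` is the exponent conjugate to `p`. -/
def dualObjective (q : ℝ) (b : M.Beliefs) : ℝ :=
  ∑ s, (∑ α, M.eps * M.cA α * entropy (b.2 s α) + ∑ v, M.eps * M.cV v * entropy (b.1 s v)
      + ∑ v, ∑ z, b.1 s v z * M.err (M.label s) v z)
    - M.C ^ (1 - q) / q * ∑ r, |M.moment b r - M.empirical r| ^ q

/-- The feasible set of the approximated dual: all beliefs are probability distributions, and
`∑_{ŷ_α ∖ ŷ_v} b_{x,y,α}(ŷ_α) = b_{x,y,v}(ŷ_v)` whenever `v ∈ N(α)`. -/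
def dualFeasible : Set M.Beliefs :=
  {b | (∀ s v, b.1 s v ∈ stdSimplex ℝ (Y v)) ∧
    (∀ s α, b.2 s α ∈ stdSimplex ℝ (M.FactorLabel α)) ∧
    ∀ s α (v : {v // v ∈ M.scope α}) (z : Y v),
      ∑ w : {w : M.FactorLabel α // w v = z}, b.2 s α w.1 = b.1 s v z}

/-- `b` solves the approximated dual program. -/
def IsDualSolution (q : ℝ) (b : M.Beliefs) : Prop :=
  b ∈ M.dualFeasible ∧ ∀ b' ∈ M.dualFeasible, M.dualObjective q b' ≤ M.dualObjective q b

/-! ### The block coordinate descent algorithm -/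

/-- `b` is a family of beliefs generated by the messages `lam` and the parameters `θ`. -/
def IsBeliefs (lam : M.Messages) (θ : R → ℝ) (b : M.Beliefs) : Prop :=
  (∀ s v, IsBelief (M.eps * M.cV v) (M.reparV lam θ s v) (b.1 s v)) ∧
    ∀ s α, IsBelief (M.eps * M.cA α) (M.reparA lam θ s α) (b.2 s α)

/-- The message `μ_{x,y,α → v}(ŷ_v)`: the soft-max at temperature `ε c_α`, over the joint labels
`ŷ_α` whose coordinate `v` is `ŷ_v`, of
`∑_{r : α ∈ E_{r,x}} θ_r φ_{r,α}(x, ŷ_α) + ∑_{u ∈ N(α) ∖ v} λ_{x,y,u → α}(ŷ_u)`. -/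
def mu (lam : M.Messages) (θ : R → ℝ) (s : S) (α : A) (v : {v // v ∈ M.scope α}) (z : Y v) : ℝ :=
  softMax (M.eps * M.cA α) (fun w : {w : M.FactorLabel α // w v = z} =>
    M.potA θ s α w.1 + ∑ u ∈ Finset.univ.erase v, lam s α u (w.1 u))

/-- The update, at the node `v`, of all messages `λ_{x,y,v → α}`, `α ∈ N(v)`, to
`(w_α / ŵ) (potential of v + ∑_{β ∈ N(v)} μ_{x,y,β → v}) - μ_{x,y,α → v} + const`, with
`ŵ = w_v + ∑_{α ∈ N(v)} w_α`. The weights `w` are the entropy weights `c`; when all the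
temperatures at `v` vanish, they are arbitrary nonnegative numbers that are not all zero. -/
def MessageUpdate (v : V) (lam : M.Messages) (θ : R → ℝ) (lam' : M.Messages) : Prop :=
  (∀ s α (u : {u // u ∈ M.scope α}), u.1 ≠ v → lam' s α u = lam s α u) ∧
  ∃ (wV : ℝ) (wA : M.Nbr v → ℝ) (k : S → M.Nbr v → ℝ),
    0 ≤ wV ∧ (∀ α, 0 ≤ wA α) ∧ 0 < wV + ∑ α, wA α ∧
    (0 < M.eps * (M.cV v + ∑ α : M.Nbr v, M.cA α.1) →
      wV = M.cV v ∧ ∀ α, wA α = M.cA α.1) ∧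
    ∀ s (α : M.Nbr v) (z : Y v), lam' s α.1 ⟨v, α.2⟩ z =
      wA α / (wV + ∑ β, wA β) *
          (M.potV θ s v z + ∑ β : M.Nbr v, M.mu lam θ s β.1 ⟨v, β.2⟩ z)
        - M.mu lam θ s α.1 ⟨v, α.2⟩ z + k s α

/-- The derivative of the objective in the direction `θ_r`, expressed through the beliefs `b`
(a subderivative when some temperatures vanish). -/
def grad (θ : R → ℝ) (b : M.Beliefs) (r : R) : ℝ :=
  M.moment b r - M.empirical r + M.C * |θ r| ^ (M.p - 1) * Real.sign (θ r)

/-- The parameters after a step of size `η` in the direction of the negative gradient in `θ_r`. -/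
def thetaStep (θ : R → ℝ) (b : M.Beliefs) (r : R) (η : ℝ) : R → ℝ :=
  Function.update θ r (θ r - η * M.grad θ b r)

/-- The step size `η` is found by exact line search. -/
def ExactStep (lam : M.Messages) (θ : R → ℝ) (b : M.Beliefs) (r : R) (η : ℝ) : Prop :=
  0 ≤ η ∧ ∀ η', 0 ≤ η' →
    M.objective lam (M.thetaStep θ b r η) ≤ M.objective lam (M.thetaStep θ b r η')

/-- The sufficient decrease (Armijo) condition with constant `σ`. -/
def SufficientDecrease (σ : ℝ) (lam : M.Messages) (θ : R → ℝ) (b : M.Beliefs) (r : R) (η : ℝ) :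
    Prop :=
  M.objective lam (M.thetaStep θ b r η) ≤ M.objective lam θ - σ * η * M.grad θ b r ^ 2

/-- The step size `η` satisfies the sufficient decrease condition and is not needlessly small:
it is at least `η₀`, or some larger step size `η' ≤ η / β` violates the condition. Backtracking from
`η₀` by the factor `β` produces such step sizes, and so do predetermined constant step sizes below
twice the reciprocal of a Lipschitz constant of the partial derivative. -/
def ArmijoStep (σ β η₀ : ℝ) (lam : M.Messages) (θ : R → ℝ) (b : M.Beliefs) (r : R) (η : ℝ) :
    Prop :=
  0 < η ∧ M.SufficientDecrease σ lam θ b r η ∧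
    (η₀ ≤ η ∨ ∃ η', η < η' ∧ η' ≤ η / β ∧ ¬ M.SufficientDecrease σ lam θ b r η')

/-- A run of the algorithm from an arbitrary starting point. At time `t` the block `sched t` is
updated: all messages leaving a node `v`, or one parameter `θ_r`. A step size `η` for `θ_r` has to be
such that the objective does not increase. -/
structure IsRun (sched : ℕ → V ⊕ R) (lam : ℕ → M.Messages) (θ : ℕ → R → ℝ) (η : ℕ → ℝ)
    (b : ℕ → M.Beliefs) : Prop where
  beliefs : ∀ t, M.IsBeliefs (lam t) (θ t) (b t)
  message_step : ∀ t v, sched t = Sum.inl v →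
    M.MessageUpdate v (lam t) (θ t) (lam (t + 1)) ∧ θ (t + 1) = θ t
  theta_step : ∀ t r, sched t = Sum.inr r →
    lam (t + 1) = lam t ∧ 0 ≤ η t ∧ θ (t + 1) = M.thetaStep (θ t) (b t) r (η t) ∧
      M.objective (lam t) (θ (t + 1)) ≤ M.objective (lam t) (θ t)

/-- Every block is updated at least once in any `T` consecutive steps, for some `T`. -/
def EssentiallyCyclic {B : Type*} (sched : ℕ → B) : Prop :=
  ∃ T : ℕ, ∀ (i : B) (t : ℕ), ∃ t', t ≤ t' ∧ t' < t + T ∧ sched t' = i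

/-- The step sizes come from a line search: each one is exact or of Armijo type, with fixed
constants. -/
def LineSearch (sched : ℕ → V ⊕ R) (lam : ℕ → M.Messages) (θ : ℕ → R → ℝ) (η : ℕ → ℝ)
    (b : ℕ → M.Beliefs) : Prop :=
  ∃ σ β η₀ : ℝ, 0 < σ ∧ σ < 1 ∧ 0 < β ∧ β < 1 ∧ 0 < η₀ ∧
    ∀ t r, sched t = Sum.inr r →
      M.ExactStep (lam t) (θ t) (b t) r (η t) ∨ M.ArmijoStep σ β η₀ (lam t) (θ t) (b t) r (η t)

end Problem

end StructPred

end

/-! The whole proof rests on the variational principle `softMax τ f = max_b (⟨b, f⟩ + τ H(b))`,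
whose maximizers are the beliefs. Its defect `gap` is nonnegative, vanishes at beliefs, and for `τ >
0` is `τ` times a Kullback–Leibler divergence, so it bounds squared distances of beliefs
(`sq_sub_le_gap`). Summing over nodes and factors gives the identity `objective_eq`, valid for every
`b`: the objective is the Lagrangian of the dual at `b` plus the total gap. Well-chosen `b` then
yield everything, without differentiating the soft-max. With `b` the beliefs at one point,
`IsBeliefs.objective_sub` writes an increment of `F` as a linear term plus gaps and Bregman
divergences; dropping these gives the gradient inequality.

Monotonicity: after an update at `v` some beliefs satisfy the marginalization constraints at `v`
(`MessageUpdate.exists_isBeliefs`), so the update lowers `F` by exactly a total gap. The uniform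
beliefs are feasible, and inserting them bounds `F` below, coercively in `θ`.

Positive temperatures: on sublevel sets the messages are bounded modulo directions that change
neither `F` nor the beliefs (`PosTemp.exists_normalization`), so a minimizer exists. There slack and
gradient vanish, the conjugacy inequality is an equality, and the beliefs solve the dual; strict
concavity of the entropy makes the solution unique.

Convergence: the decrease of `F` controls each step (`IsRun.stepClose`), so beliefs and parameters
move by increments tending to zero. A block's slack or gradient is zero or small when the block is
visited; as visits have bounded gaps, all slacks and gradients tend to zero. The gradient inequality
at bounded representatives of the iterates gives `F → min F`, and `F - min F` dominates the gap of
the optimal beliefs. -/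

set_option linter.unusedSectionVars false

noncomputable section

namespace StructPred

/-! ### The variational principle for the soft-max -/

section SoftMax

variable {ι : Type*} [Fintype ι]

/-- The defect of `b` in the variational principle `softMax τ f = max_b (⟨b, f⟩ + τ H(b))`. -/
def gap (τ : ℝ) (f b : ι → ℝ) : ℝ := softMax τ f - ∑ i, b i * f i - τ * entropy b

theorem softMax_zero (f : ι → ℝ) : softMax 0 f = ⨆ i, f i := by simp [softMax]

theorem softMax_of_ne {τ : ℝ} (hτ : τ ≠ 0) (f : ι → ℝ) :
    softMax τ f = τ * Real.log (∑ i, Real.exp (f i / τ)) := by simp [softMax, hτ]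

theorem isBelief_zero {f b : ι → ℝ} :
    IsBelief 0 f b ↔ b ∈ stdSimplex ℝ ι ∧ ∀ i, 0 < b i → ∀ j, f j ≤ f i := by simp [IsBelief]

theorem isBelief_of_ne {τ : ℝ} (hτ : τ ≠ 0) {f b : ι → ℝ} :
    IsBelief τ f b ↔ ∀ i, b i = Real.exp (f i / τ) / ∑ j, Real.exp (f j / τ) := by
  simp [IsBelief, hτ]

variable [Nonempty ι]

theorem sum_exp_pos (f : ι → ℝ) : 0 < ∑ i, Real.exp (f i) :=
  Finset.sum_pos (fun _ _ => Real.exp_pos _) Finset.univ_nonempty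

theorem exists_isBelief (τ : ℝ) (f : ι → ℝ) : ∃ b, IsBelief τ f b := by
  classical
  by_cases hτ : τ = 0
  · obtain ⟨i, hi⟩ := Finite.exists_max f
    refine ⟨Pi.single i 1, ?_⟩
    rw [hτ, isBelief_zero]
    refine ⟨single_mem_stdSimplex ℝ i, fun k hk => ?_⟩
    have : k = i := by
      by_contra h
      simp [h] at hk
    exact this ▸ hi
  · exact ⟨_, (isBelief_of_ne hτ).2 fun i => rfl⟩

theorem IsBelief.mem_stdSimplex {τ : ℝ} {f b : ι → ℝ} (hb : IsBelief τ f b) :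
    b ∈ stdSimplex ℝ ι := by
  by_cases hτ : τ = 0
  · rw [hτ, isBelief_zero] at hb
    exact hb.1
  · rw [isBelief_of_ne hτ] at hb
    have hZ := sum_exp_pos fun i => f i / τ
    refine ⟨fun i => ?_, ?_⟩
    · rw [hb]
      positivity
    · simp_rw [hb]
      rw [← Finset.sum_div, div_self hZ.ne']

theorem IsBelief.pos {τ : ℝ} (hτ : τ ≠ 0) {f b : ι → ℝ} (hb : IsBelief τ f b) (i : ι) :
    0 < b i := by
  rw [(isBelief_of_ne hτ).1 hb]
  exact div_pos (Real.exp_pos _) (sum_exp_pos fun i => f i / τ)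

theorem IsBelief.apply_eq {τ : ℝ} (hτ : τ ≠ 0) {f b : ι → ℝ} (hb : IsBelief τ f b) (i : ι) :
    f i = τ * Real.log (b i) + softMax τ f := by
  rw [(isBelief_of_ne hτ).1 hb, Real.log_div (Real.exp_pos _).ne' (sum_exp_pos fun i => f i / τ).ne',
    Real.log_exp, softMax_of_ne hτ]
  field_simp
  ring

theorem softMax_add_const (τ : ℝ) (f : ι → ℝ) (k : ℝ) :
    softMax τ (fun i => f i + k) = softMax τ f + k := by
  by_cases hτ : τ = 0
  · rw [hτ, softMax_zero, softMax_zero, ciSup_add (Finite.bddAbove_range f)]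
  · have : ∑ i, Real.exp ((f i + k) / τ) = (∑ i, Real.exp (f i / τ)) * Real.exp (k / τ) := by
      rw [Finset.sum_mul]
      refine Finset.sum_congr rfl fun i _ => ?_
      rw [← Real.exp_add, add_div]
    rw [softMax_of_ne hτ, softMax_of_ne hτ, this,
      Real.log_mul (sum_exp_pos fun i => f i / τ).ne' (Real.exp_pos _).ne', Real.log_exp]
    field_simp

/-- Substituting `f i = τ log (b' i) + softMax τ f` turns the gap into `τ` times the
Kullback–Leibler divergence of `b` from `b'`. -/
theorem gap_eq_sum {τ : ℝ} (hτ : τ ≠ 0) {f b b' : ι → ℝ} (hb : ∑ i, b i = 1)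
    (hb' : IsBelief τ f b') :
    gap τ f b = τ * ∑ i, (b i * Real.log (b i) - b i * Real.log (b' i)) := by
  have h : ∑ i, b i * f i = τ * ∑ i, b i * Real.log (b' i) + softMax τ f := by
    have : ∀ i, b i * f i = τ * (b i * Real.log (b' i)) + b i * softMax τ f := fun i => by
      rw [hb'.apply_eq hτ i]
      ring
    rw [Finset.sum_congr rfl fun i _ => this i, Finset.sum_add_distrib, ← Finset.mul_sum,
      ← Finset.sum_mul, hb, one_mul]
  have h2 : entropy b = - ∑ i, b i * Real.log (b i) := by
    simp [entropy, Real.negMulLog]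
  rw [gap, h, h2, Finset.sum_sub_distrib]
  ring

/-- This is `log t ≤ t - 1` at `t = √y / √x`, multiplied by `2x`. Summed over two distributions, the
term `x - y` cancels and the divergence dominates the squared Hellinger distance. -/
theorem sq_sqrt_sub_le {x y : ℝ} (hx : 0 ≤ x) (hy : 0 < y) :
    x - y + (√x - √y) ^ 2 ≤ x * Real.log x - x * Real.log y := by
  have hxx := Real.sq_sqrt hx
  have hyy := Real.sq_sqrt hy.le
  rcases hx.eq_or_lt with rfl | hx
  · simp [hyy]
  · have h1 := Real.log_le_sub_one_of_pos (x := √y / √x) (by positivity)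
    rw [Real.log_div (by positivity) (by positivity), Real.log_sqrt hx.le,
      Real.log_sqrt hy.le] at h1
    have h2 : x * (√y / √x) = √x * √y := by
      have : √x ≠ 0 := by positivity
      field_simp
      rw [hxx]
    nlinarith [mul_le_mul_of_nonneg_left h1 hx.le]

/-- A Pinsker-type bound via the Hellinger distance: factor `b - b' = (√b - √b')(√b + √b')`, where
the second factor is at most `2`. It converts decrease of the objective into closeness of beliefs.
-/
theorem sq_sub_le_gap {τ : ℝ} (hτ : 0 < τ) {f b b' : ι → ℝ} (hb : b ∈ stdSimplex ℝ ι)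
    (hb' : IsBelief τ f b') (i : ι) : (b i - b' i) ^ 2 ≤ 4 / τ * gap τ f b := by
  have hs := hb'.mem_stdSimplex
  have h1 : (√(b i) - √(b' i)) ^ 2 ≤ ∑ i, (b i * Real.log (b i) - b i * Real.log (b' i)) := by
    calc (√(b i) - √(b' i)) ^ 2 ≤ ∑ i, (√(b i) - √(b' i)) ^ 2 :=
          Finset.single_le_sum (f := fun i => (√(b i) - √(b' i)) ^ 2)
            (fun _ _ => sq_nonneg _) (Finset.mem_univ i)
      _ = ∑ i, (b i - b' i + (√(b i) - √(b' i)) ^ 2) := by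
          rw [Finset.sum_add_distrib, Finset.sum_sub_distrib, hb.2, hs.2]
          ring
      _ ≤ _ := Finset.sum_le_sum fun j _ => sq_sqrt_sub_le (hb.1 j) (hb'.pos hτ.ne' j)
  have hle : ∀ {c : ι → ℝ}, c ∈ stdSimplex ℝ ι → c i ≤ 1 := fun {c} hc => by
    rw [← hc.2]
    exact Finset.single_le_sum (fun j _ => hc.1 j) (Finset.mem_univ i)
  have h2 : (b i - b' i) ^ 2 = (√(b i) - √(b' i)) ^ 2 * (√(b i) + √(b' i)) ^ 2 := by
    have : b i - b' i = √(b i) ^ 2 - √(b' i) ^ 2 := by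
      rw [Real.sq_sqrt (hb.1 i), Real.sq_sqrt (hs.1 i)]
    rw [this]
    ring
  have h3 : √(b i) + √(b' i) ≤ 2 := by
    have := Real.sqrt_le_one.2 (hle hb)
    have := Real.sqrt_le_one.2 (hle hs)
    linarith
  have h4 : (√(b i) + √(b' i)) ^ 2 ≤ 4 := by
    have := Real.sqrt_nonneg (b i)
    have := Real.sqrt_nonneg (b' i)
    nlinarith
  rw [gap_eq_sum hτ.ne' hb.2 hb', h2, ← mul_assoc, div_mul_cancel₀ _ hτ.ne']
  calc _ ≤ (√(b i) - √(b' i)) ^ 2 * 4 := mul_le_mul_of_nonneg_left h4 (sq_nonneg _)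
    _ ≤ _ := by linarith

theorem gap_nonneg {τ : ℝ} (hτ : 0 ≤ τ) (f : ι → ℝ) {b : ι → ℝ} (hb : b ∈ stdSimplex ℝ ι) :
    0 ≤ gap τ f b := by
  rcases hτ.eq_or_lt with rfl | hτ
  · rw [gap, softMax_zero, zero_mul, sub_zero, sub_nonneg]
    calc ∑ i, b i * f i ≤ ∑ i, b i * ⨆ i, f i := Finset.sum_le_sum fun i _ =>
          mul_le_mul_of_nonneg_left (le_ciSup (Finite.bddAbove_range f) i) (hb.1 i)
      _ = _ := by rw [← Finset.sum_mul, hb.2, one_mul]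
  · obtain ⟨b', hb'⟩ := exists_isBelief τ f
    have := (sq_nonneg _).trans (sq_sub_le_gap hτ hb hb' (Classical.arbitrary ι))
    exact nonneg_of_mul_nonneg_right this (by positivity)

theorem IsBelief.gap_eq_zero {τ : ℝ} {f b : ι → ℝ} (hb : IsBelief τ f b) : gap τ f b = 0 := by
  by_cases hτ : τ = 0
  · have hs := hb.mem_stdSimplex
    rw [hτ, isBelief_zero] at hb
    rw [gap, hτ, softMax_zero, zero_mul, sub_zero, sub_eq_zero, ← one_mul (⨆ i, f i), ← hs.2,
      Finset.sum_mul]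
    refine Finset.sum_congr rfl fun i _ => ?_
    rcases (hs.1 i).eq_or_lt with h | h
    · rw [← h, zero_mul, zero_mul]
    · congr 1
      exact le_antisymm (ciSup_le (hb.2 i h)) (le_ciSup (Finite.bddAbove_range f) i)
  · rw [gap_eq_sum hτ hb.mem_stdSimplex.2 hb]
    simp

/-- A lower bound on the Gibbs distribution in terms of the gap of a reference distribution. -/
theorem mul_neg_log_le_gap {τ : ℝ} (hτ : 0 < τ) {f b u : ι → ℝ} (hu : u ∈ stdSimplex ℝ ι)
    (hb : IsBelief τ f b) (i : ι) :
    τ * (u i * -Real.log (b i)) ≤ gap τ f u + τ * entropy u := by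
  have h2 : entropy u = - ∑ i, u i * Real.log (u i) := by
    simp [entropy, Real.negMulLog]
  have hs := hb.mem_stdSimplex
  have h : gap τ f u + τ * entropy u = τ * ∑ i, u i * -Real.log (b i) := by
    rw [gap_eq_sum hτ.ne' hu.2 hb, h2, Finset.sum_sub_distrib]
    simp only [mul_neg, Finset.sum_neg_distrib]
    ring
  rw [h]
  refine mul_le_mul_of_nonneg_left ?_ hτ.le
  refine Finset.single_le_sum (f := fun i => u i * -Real.log (b i)) (fun j _ => ?_)
    (Finset.mem_univ i)
  refine mul_nonneg (hu.1 j) (neg_nonneg.2 (Real.log_nonpos (hs.1 j) ?_))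
  rw [← hs.2]
  exact Finset.single_le_sum (fun j _ => hs.1 j) (Finset.mem_univ j)

/-- Beliefs do not change when temperature and potential are scaled by the same number. -/
theorem IsBelief.smul {τ c : ℝ} (hc : 0 ≤ c) {f b : ι → ℝ} (k : ℝ)
    (hb : IsBelief τ f b) : IsBelief (c * τ) (fun i => c * f i + k) b := by
  have hs := hb.mem_stdSimplex
  rcases hc.eq_or_lt with rfl | hc
  -- At scale zero both temperature and oscillation vanish, and every distribution is a belief. This
  -- case is met when a weight in the message update is zero.
  · simp only [zero_mul, zero_add]
    exact isBelief_zero.2 ⟨hs, fun _ _ _ => le_rfl⟩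
  · by_cases hτ : τ = 0
    · rw [hτ, isBelief_zero] at hb
      rw [hτ, mul_zero, isBelief_zero]
      refine ⟨hs, fun i hi j => ?_⟩
      have := mul_le_mul_of_nonneg_left (hb.2 i hi j) hc.le
      linarith
    · rw [isBelief_of_ne hτ] at hb
      rw [isBelief_of_ne (mul_ne_zero hc.ne' hτ)]
      intro i
      have h : ∀ j, Real.exp ((c * f j + k) / (c * τ))
          = Real.exp (f j / τ) * Real.exp (k / (c * τ)) := fun j => by
        rw [← Real.exp_add]
        congr 1
        field_simp
      simp_rw [h]
      rw [← Finset.sum_mul, mul_div_mul_right _ _ (Real.exp_pos _).ne', hb]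

theorem IsBelief.add_const {τ : ℝ} {f f' b : ι → ℝ} (k : ℝ)
    (hb : IsBelief τ f b) (hf : ∀ i, f' i = f i + k) : IsBelief τ f' b := by
  have := hb.smul zero_le_one k
  simp only [one_mul] at this
  rwa [funext hf]

/-- A belief for the soft-max over the fibres of a map lifts to a belief. -/
theorem IsBelief.exists_lift {κ : Type*} [Fintype κ] [DecidableEq κ] {π : ι → κ}
    (hπ : Function.Surjective π) {τ : ℝ} {f : ι → ℝ} {c : κ → ℝ}
    (hc : IsBelief τ (fun z => softMax τ fun w : {w // π w = z} => f w.1) c) :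
    ∃ b, IsBelief τ f b ∧ ∀ z, ∑ w : {w // π w = z}, b w.1 = c z := by
  classical
  have hne : ∀ z, Nonempty {w // π w = z} := fun z => let ⟨w, hw⟩ := hπ z; ⟨⟨w, hw⟩⟩
  have hκ : Nonempty κ := Nonempty.map π ‹_›
  have hfib : ∀ h : ι → ℝ, ∑ w, h w = ∑ z, ∑ w : {w // π w = z}, h w.1 := fun h =>
    (Fintype.sum_fiberwise π h).symm
  by_cases hτ : τ = 0
  · subst hτ
    rw [isBelief_zero] at hc
    simp only [softMax_zero] at hc
    -- At zero temperature the lift puts the whole mass `c z` on one maximizer `m z` of `f` in the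
    -- fibre over `z`.
    choose m hm using fun z => Finite.exists_max fun w : {w // π w = z} => f w.1
    have hsup : ∀ z, ⨆ w : {w // π w = z}, f w.1 = f (m z).1 := fun z =>
      le_antisymm (ciSup_le (hm z)) (le_ciSup (f := fun w : {w // π w = z} => f w.1)
        (Finite.bddAbove_range _) (m z))
    have hsum : ∀ z, ∑ w : {w // π w = z}, (if w.1 = (m (π w.1)).1 then c (π w.1) else 0) = c z := by
      intro z
      rw [Finset.sum_eq_single (m z)]
      · rw [(m z).2, if_pos rfl]
      · rintro ⟨w, rfl⟩ _ hw
        rw [if_neg]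
        exact fun h => hw (Subtype.ext h)
      · simp
    refine ⟨fun w => if w = (m (π w)).1 then c (π w) else 0, isBelief_zero.2 ⟨⟨fun w => ?_, ?_⟩, ?_⟩,
      hsum⟩
    · dsimp only
      split_ifs
      · exact hc.1.1 _
      · exact le_rfl
    · rw [hfib, ← hc.1.2]
      exact Finset.sum_congr rfl fun z _ => hsum z
    · intro w hw j
      split_ifs at hw with h
      · have h1 := hc.2 _ hw (π j)
        rw [hsup, hsup, ← h] at h1
        exact (hm (π j) ⟨j, rfl⟩).trans h1
      · exact absurd hw (lt_irrefl _)
  · rw [isBelief_of_ne hτ] at hc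
    -- Exponentiating a fibrewise soft-max gives the fibre's partition sum, so the Gibbs
    -- distribution of `f` already has marginal `c`.
    have h : ∀ z, Real.exp ((softMax τ fun w : {w // π w = z} => f w.1) / τ)
        = ∑ w : {w // π w = z}, Real.exp (f w.1 / τ) := fun z => by
      rw [softMax_of_ne hτ, mul_div_cancel_left₀ _ hτ,
        Real.exp_log (sum_exp_pos fun w : {w // π w = z} => f w.1 / τ)]
    refine ⟨_, (isBelief_of_ne hτ).2 fun i => rfl, fun z => ?_⟩
    rw [hc]
    simp_rw [h]
    rw [← Finset.sum_div, hfib fun w => Real.exp (f w / τ)]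

theorem continuous_softMax {τ : ℝ} (hτ : τ ≠ 0) : Continuous fun f : ι → ℝ => softMax τ f := by
  simp only [softMax_of_ne hτ]
  refine continuous_const.mul (Continuous.log (by fun_prop) fun f => ?_)
  exact (sum_exp_pos fun i => f i / τ).ne'

end SoftMax

/-! ### The regularizer `|x| ^ p / p` -/

section Power

/-- The derivative of `|x| ^ p / p`. -/
def dpow (p x : ℝ) : ℝ := |x| ^ (p - 1) * Real.sign x

/-- The Bregman divergence of `|x| ^ p / p`. -/
def bregman (p y x : ℝ) : ℝ := (|y| ^ p - |x| ^ p) / p - dpow p x * (y - x)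

theorem hasDerivAt_abs_rpow_dpow {p : ℝ} (hp : 1 < p) (x : ℝ) :
    HasDerivAt (fun x : ℝ => |x| ^ p) (p * dpow p x) x := by
  convert hasDerivAt_abs_rpow x hp using 1
  rw [dpow, mul_assoc]
  congr 1
  rcases lt_trichotomy x 0 with h | rfl | h
  · have h1 : |x| ^ (p - 1) = |x| ^ (p - 2) * |x| := by
      rw [← Real.rpow_add_one (by simpa using h.ne)]
      ring_nf
    rw [h1, Real.sign_of_neg h, abs_of_neg h]
    ring
  · simp
  · have h1 : |x| ^ (p - 1) = |x| ^ (p - 2) * |x| := by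
      rw [← Real.rpow_add_one (by simpa using h.ne')]
      ring_nf
    rw [h1, Real.sign_of_pos h, abs_of_pos h]
    ring

theorem continuous_dpow {p : ℝ} (hp : 1 < p) : Continuous (dpow p) := by
  have h : Continuous (deriv fun x : ℝ => ‖x‖ ^ p) := (contDiff_norm_rpow hp).continuous_deriv le_rfl
  have h2 : dpow p = fun x => p⁻¹ * deriv (fun x : ℝ => ‖x‖ ^ p) x := by
    funext x
    have := (hasDerivAt_abs_rpow_dpow hp x).deriv
    simp only [Real.norm_eq_abs]
    rw [this, inv_mul_cancel_left₀ (by positivity)]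
  rw [h2]
  exact continuous_const.mul h

theorem dpow_strictMono {p : ℝ} (hp : 1 < p) : StrictMono (dpow p) := by
  have hp' : 0 < p - 1 := by linarith
  have hpos : ∀ {x : ℝ}, 0 ≤ x → dpow p x = x ^ (p - 1) := fun {x} hx => by
    rcases hx.eq_or_lt with rfl | hx
    · simp [dpow, hp'.ne']
    · rw [dpow, Real.sign_of_pos hx, abs_of_pos hx, mul_one]
  have hneg : ∀ {x : ℝ}, x < 0 → dpow p x = -(-x) ^ (p - 1) := fun {x} hx => by
    rw [dpow, Real.sign_of_neg hx, abs_of_neg hx, mul_neg_one]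
  intro x y hxy
  rcases le_or_gt 0 x with hx | hx
  · rw [hpos hx, hpos (hx.trans hxy.le)]
    exact Real.rpow_lt_rpow hx hxy hp'
  · rw [hneg hx]
    have h1 : 0 < (-x) ^ (p - 1) := Real.rpow_pos_of_pos (neg_pos.2 hx) _
    rcases le_or_gt 0 y with hy | hy
    · rw [hpos hy]
      have := Real.rpow_nonneg hy (p - 1)
      linarith
    · rw [hneg hy, neg_lt_neg_iff]
      exact Real.rpow_lt_rpow (neg_pos.2 hy).le (neg_lt_neg hxy) hp'

theorem strictConvexOn_abs_rpow {p : ℝ} (hp : 1 < p) :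
    StrictConvexOn ℝ Set.univ fun x : ℝ => |x| ^ p := by
  refine StrictMono.strictConvexOn_univ_of_deriv
    (continuous_abs.rpow_const fun x => Or.inr (by linarith)) ?_
  rw [show deriv (fun x : ℝ => |x| ^ p) = fun x => p * dpow p x from
    funext fun x => (hasDerivAt_abs_rpow_dpow hp x).deriv]
  exact (dpow_strictMono hp).const_mul (by linarith)

theorem bregman_pos {p : ℝ} (hp : 1 < p) {x y : ℝ} (hxy : y ≠ x) : 0 < bregman p y x := by
  have hc := strictConvexOn_abs_rpow hp
  have hd := hasDerivAt_abs_rpow_dpow hp x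
  have hp0 : 0 < p := by linarith
  have key : p * dpow p x * (y - x) < |y| ^ p - |x| ^ p := by
    rcases hxy.lt_or_gt with h | h
    · have := hc.slope_lt_of_hasDerivAt (Set.mem_univ y) (Set.mem_univ x) h hd
      rw [slope_def_field, div_lt_iff₀ (by linarith)] at this
      linarith
    · have := hc.lt_slope_of_hasDerivAt (Set.mem_univ x) (Set.mem_univ y) h hd
      rw [slope_def_field, lt_div_iff₀ (by linarith)] at this
      linarith
  have h2 : bregman p y x = ((|y| ^ p - |x| ^ p) - p * dpow p x * (y - x)) / p := by
    rw [bregman]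
    field_simp
  rw [h2]
  exact div_pos (by linarith) hp0

theorem bregman_nonneg {p : ℝ} (hp : 1 < p) (x y : ℝ) : 0 ≤ bregman p y x := by
  by_cases h : y = x
  · simp [bregman, h]
  · exact (bregman_pos hp h).le

/-- On bounded sets, a small Bregman divergence forces a small distance. -/
theorem exists_bregman_lt {p : ℝ} (hp : 1 < p) (B : ℝ) {ε : ℝ} (hε : 0 < ε) :
    ∃ δ > 0, ∀ x y, |x| ≤ B → |y| ≤ B → bregman p y x < δ → |y - x| < ε := by
  -- On the compact set of pairs at distance at least `ε` the divergence is continuous and positive;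
  -- its minimum serves as `δ`.
  set K : Set (ℝ × ℝ) := (Set.Icc (-B) B ×ˢ Set.Icc (-B) B) ∩ {z | ε ≤ |z.2 - z.1|} with hK
  have hKc : IsCompact K := (isCompact_Icc.prod isCompact_Icc).inter_right
    (isClosed_le (by fun_prop) (by fun_prop))
  have hcont : Continuous fun z : ℝ × ℝ => bregman p z.2 z.1 := by
    have h1 : Continuous fun x : ℝ => |x| ^ p :=
      continuous_abs.rpow_const fun x => Or.inr (by linarith)
    have := continuous_dpow hp
    unfold bregman
    exact (((h1.comp continuous_snd).sub (h1.comp continuous_fst)).div_const p).sub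
      ((this.comp continuous_fst).mul (continuous_snd.sub continuous_fst))
  rcases K.eq_empty_or_nonempty with h | h
  · refine ⟨1, one_pos, fun x y hx hy _ => ?_⟩
    by_contra hxy
    have : (x, y) ∈ K := ⟨⟨abs_le.1 hx, abs_le.1 hy⟩, not_lt.1 hxy⟩
    rw [h] at this
    exact this
  · obtain ⟨z, hz, hmin⟩ := hKc.exists_isMinOn h hcont.continuousOn
    refine ⟨bregman p z.2 z.1, bregman_pos hp fun h => ?_, fun x y hx hy hlt => ?_⟩
    · have := hz.2
      simp only [Set.mem_ofPred_eq, h, sub_self, abs_zero] at this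
      linarith
    · by_contra hxy
      have : (x, y) ∈ K := ⟨⟨abs_le.1 hx, abs_le.1 hy⟩, not_lt.1 hxy⟩
      exact absurd (hmin this) (not_le.2 hlt)

variable {p q C : ℝ}

/-- The conjugate of `C / p * |x| ^ p` is `C ^ (1 - q) / q * |a| ^ q`. -/
theorem neg_conj_le (hpq : p.HolderConjugate q) (hC : 0 < C) (a x : ℝ) :
    -(C ^ (1 - q) / q * |a| ^ q) ≤ a * x + C / p * |x| ^ p := by
  have hp := hpq.pos
  have hq := hpq.symm.pos
  -- The factors `C ^ (± 1/p)` cancel in the product and become `C` and `C ^ (-q/p) = C ^ (1 - q)`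
  -- in the powers.
  have h := Real.young_inequality (C ^ (1 / p) * x) (-a * C ^ (-(1 / p))) hpq
  have h0 : C ^ (1 / p) * C ^ (-(1 / p)) = 1 := by
    rw [← Real.rpow_add hC, add_neg_cancel, Real.rpow_zero]
  have h1 : |C ^ (1 / p) * x| ^ p = C * |x| ^ p := by
    rw [abs_mul, abs_of_pos (by positivity), Real.mul_rpow (by positivity) (abs_nonneg _),
      ← Real.rpow_mul hC.le, one_div_mul_cancel hp.ne', Real.rpow_one]
  have h2 : |-a * C ^ (-(1 / p))| ^ q = C ^ (1 - q) * |a| ^ q := by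
    rw [abs_mul, abs_neg, abs_of_pos (a := C ^ _) (by positivity),
      Real.mul_rpow (abs_nonneg _) (by positivity), ← Real.rpow_mul hC.le, mul_comm]
    congr 2
    have := hpq.symm.sub_one_mul_conj
    field_simp
    linarith
  have h3 : C ^ (1 / p) * x * (-a * C ^ (-(1 / p))) = -(a * x) := by
    linear_combination -(a * x) * h0
  rw [h1, h2, h3] at h
  have e1 : C / p * |x| ^ p = C * |x| ^ p / p := by ring
  have e2 : C ^ (1 - q) / q * |a| ^ q = C ^ (1 - q) * |a| ^ q / q := by ring
  rw [e1, e2]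
  linarith

theorem abs_rpow_eq_dpow_mul (hp : 1 < p) (x : ℝ) : |x| ^ p = dpow p x * x := by
  rcases eq_or_ne x 0 with rfl | h
  · simp [(zero_lt_one.trans hp).ne']
  · have h1 : |x| ^ p = |x| ^ (p - 1) * |x| := by
      rw [← Real.rpow_add_one (by simpa using h)]
      ring_nf
    rw [h1, dpow, mul_assoc]
    congr 1
    rcases h.lt_or_gt with h | h
    · rw [Real.sign_of_neg h, abs_of_neg h, neg_one_mul]
    · rw [Real.sign_of_pos h, abs_of_pos h, one_mul]

/-- The equality case of `neg_conj_le`: at the stationary point both sides are `-(C / q) * |x| ^ p`.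
It closes the duality gap. -/
theorem neg_conj_eq (hpq : p.HolderConjugate q) (hC : 0 < C) {a x : ℝ} (ha : a + C * dpow p x = 0) :
    -(C ^ (1 - q) / q * |a| ^ q) = a * x + C / p * |x| ^ p := by
  have hp := hpq.pos
  have hq := hpq.symm.pos
  have h1 : |a| ^ q = C ^ q * |x| ^ p := by
    have h2 : |a| = C * |x| ^ (p - 1) := by
      have hs : |x| ^ (p - 1) * |Real.sign x| = |x| ^ (p - 1) := by
        rcases lt_trichotomy x 0 with h | rfl | h
        · simp [Real.sign_of_neg h]
        · simp [hpq.sub_one_pos.ne']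
        · simp [Real.sign_of_pos h]
      rw [show a = -(C * dpow p x) by linarith, abs_neg, abs_mul, abs_of_pos hC, dpow, abs_mul,
        abs_of_nonneg (a := |x| ^ (p - 1)) (by positivity), hs]
    rw [h2, Real.mul_rpow hC.le (by positivity), ← Real.rpow_mul (abs_nonneg _),
      hpq.sub_one_mul_conj]
  have h3 : C ^ (1 - q) * C ^ q = C := by
    rw [← Real.rpow_add hC]
    simp
  have h4 : a * x = -C * |x| ^ p := by
    rw [abs_rpow_eq_dpow_mul hpq.lt]
    linear_combination x * ha
  have h5 : 1 / q = 1 - 1 / p := by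
    have := hpq.inv_add_inv_eq_one
    simp only [one_div]
    linarith
  rw [h1, h4]
  calc -(C ^ (1 - q) / q * (C ^ q * |x| ^ p)) = -(C ^ (1 - q) * C ^ q) * |x| ^ p * (1 / q) := by ring
    _ = _ := by
      rw [h3, h5]
      ring

/-- Applying `neg_conj_le` to `a - sign x` leaves `|x|` to spare, at a cost independent of `x`. This
is the coercivity in `θ`. -/
theorem abs_sub_conj_le (hpq : p.HolderConjugate q) (hC : 0 < C) (a x : ℝ) :
    |x| - C ^ (1 - q) / q * (|a| + 1) ^ q ≤ a * x + C / p * |x| ^ p := by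
  have hq := hpq.symm.pos
  have h1 := neg_conj_le hpq hC (a - SignType.sign x) x
  have h2 : |a - SignType.sign x| ≤ |a| + 1 := by
    refine (abs_sub _ _).trans (add_le_add_right ?_ _)
    rcases lt_trichotomy x 0 with h | rfl | h <;> simp [*]
  have h3 : C ^ (1 - q) / q * |a - SignType.sign x| ^ q ≤ C ^ (1 - q) / q * (|a| + 1) ^ q :=
    mul_le_mul_of_nonneg_left (Real.rpow_le_rpow (abs_nonneg _) h2 hq.le) (by positivity)
  have h4 : SignType.sign x * x = |x| := sign_mul_self x
  nlinarith

end Power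

/-! ### Sequences -/

/-- A sequence that is small at the times when a block is visited, and whose increments tend to
zero, tends to zero if the block is visited at least once in any `T` consecutive steps. -/
theorem tendsto_zero_of_visits {P : ℕ → Prop} {T : ℕ}
    (hP : ∀ t, ∃ t', t ≤ t' ∧ t' < t + T ∧ P t') {u : ℕ → ℝ}
    (hu : ∀ ε > 0, ∀ᶠ t in atTop, P t → |u t| < ε)
    (hd : Tendsto (fun t => u (t + 1) - u t) atTop (𝓝 0)) : Tendsto u atTop (𝓝 0) := by
  have hj : ∀ j : ℕ, Tendsto (fun t => u (t + j) - u t) atTop (𝓝 0) := by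
    intro j
    induction j with
    | zero => simp
    | succ j ih =>
      have h := (hd.comp (tendsto_add_atTop_nat j)).add ih
      simp only [add_zero] at h
      refine h.congr fun t => ?_
      simp only [Function.comp]
      rw [← add_assoc]
      ring
  rw [Metric.tendsto_nhds]
  intro ε hε
  -- Only the finitely many shifts `j < T` matter, since the next visit after `t` lies within this
  -- window.
  have h1 : ∀ᶠ t in atTop, ∀ j ∈ Finset.range T, |u (t + j) - u t| < ε / 2 := by
    rw [eventually_all_finset]
    intro j _
    have := Metric.tendsto_nhds.1 (hj j) (ε / 2) (by positivity)
    simpa [Real.dist_eq] using this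
  obtain ⟨t₀, ht₀⟩ := eventually_atTop.1 (hu (ε / 2) (by positivity))
  filter_upwards [h1, eventually_ge_atTop t₀] with t ht htt
  obtain ⟨t', h1', h2', h3'⟩ := hP t
  obtain ⟨j, rfl⟩ := Nat.exists_eq_add_of_le h1'
  have a1 := ht j (Finset.mem_range.2 (by omega))
  have a2 := ht₀ (t + j) (by omega) h3'
  rw [Real.dist_eq, sub_zero]
  rw [abs_lt] at *
  constructor <;> linarith

namespace Problem

/-! ### The Lagrangian identity -/

theorem sum_mul_sum_ite {B R : Type*} [Fintype B] [Fintype R] {Z : B → Type*}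
    [∀ v, Fintype (Z v)] (N : R → Finset B)
    [∀ r v, Decidable (v ∈ N r)] (θ : R → ℝ) (φ : R → (v : B) → Z v → ℝ)
    (b : (v : B) → Z v → ℝ) :
    ∑ v, ∑ z, b v z * ∑ r, (if v ∈ N r then θ r * φ r v z else 0)
      = ∑ r, θ r * ∑ v ∈ N r, ∑ z, b v z * φ r v z := by
  simp_rw [Finset.mul_sum]
  calc _ = ∑ v, ∑ r, ∑ z, b v z * (if v ∈ N r then θ r * φ r v z else 0) :=
        Finset.sum_congr rfl fun v _ => Finset.sum_comm
    _ = ∑ r, ∑ v, ∑ z, b v z * (if v ∈ N r then θ r * φ r v z else 0) := Finset.sum_comm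
    _ = _ := Finset.sum_congr rfl fun r _ => by
      rw [← Finset.sum_subset (Finset.subset_univ (N r))]
      · refine Finset.sum_congr rfl fun v hv => Finset.sum_congr rfl fun z _ => ?_
        rw [if_pos hv]
        ring
      · intro v _ hv
        simp [hv]

variable {V A R S X : Type*} {Y : V → Type*}
  [Fintype V] [DecidableEq V] [Fintype A] [Fintype R] [DecidableEq R] [Fintype S]
  [∀ v, Fintype (Y v)] [∀ v, DecidableEq (Y v)]
  (M : Problem V A R S X Y)

omit [∀ v, Fintype (Y v)] [∀ v, DecidableEq (Y v)] [Fintype R] [DecidableEq R] [Fintype S] in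
theorem sum_nbr_comm (f : (α : A) → {v // v ∈ M.scope α} → ℝ) :
    ∑ v, ∑ α : M.Nbr v, f α.1 ⟨v, α.2⟩ = ∑ α, ∑ u, f α u := by
  simp_rw [Finset.sum_sigma', Finset.univ_sigma_univ]
  exact Fintype.sum_equiv
    (⟨fun x => ⟨x.2.1, x.1, x.2.2⟩, fun x => ⟨x.2.1, x.1, x.2.2⟩, fun _ => rfl, fun _ => rfl⟩ :
      (Σ v, M.Nbr v) ≃ Σ α, {v // v ∈ M.scope α}) _ _ fun _ => rfl

/-- The violation of the marginalization constraints by the beliefs `b`. -/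
def slack (b : M.Beliefs) (s : S) (α : A) (v : {v // v ∈ M.scope α}) (z : Y v) : ℝ :=
  ∑ w : {w : M.FactorLabel α // w v = z}, b.2 s α w.1 - b.1 s v z

/-- The total gap of the beliefs `b` in the variational principles at `(lam, θ)`. -/
def totalGap (lam : M.Messages) (θ : R → ℝ) (b : M.Beliefs) : ℝ :=
  ∑ s, ∑ v, gap (M.eps * M.cV v) (M.reparV lam θ s v) (b.1 s v)
    + ∑ s, ∑ α, gap (M.eps * M.cA α) (M.reparA lam θ s α) (b.2 s α)

/-- The part of the dual objective that does not involve the moments. -/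
def entropyPart (b : M.Beliefs) : ℝ :=
  ∑ s, (∑ α, M.eps * M.cA α * entropy (b.2 s α) + ∑ v, M.eps * M.cV v * entropy (b.1 s v)
      + ∑ v, ∑ z, b.1 s v z * M.err (M.label s) v z)

/-- The pairing of messages with the violation of the constraints. -/
def slackPairing (lam : M.Messages) (b : M.Beliefs) : ℝ :=
  ∑ s, ∑ α, ∑ u, ∑ z, lam s α u z * M.slack b s α u z

theorem sum_factor_messages (s : S) (lam : M.Messages) (b : M.Beliefs) :
    ∑ α, ∑ w, b.2 s α w * ∑ u, lam s α u (w u)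
      = ∑ α, ∑ u, ∑ z, lam s α u z * ∑ w : {w : M.FactorLabel α // w u = z}, b.2 s α w.1 := by
  refine Finset.sum_congr rfl fun α _ => ?_
  simp_rw [Finset.mul_sum]
  rw [Finset.sum_comm]
  refine Finset.sum_congr rfl fun u _ => ?_
  rw [← Fintype.sum_fiberwise (fun w : M.FactorLabel α => w u)]
  refine Finset.sum_congr rfl fun z _ => Finset.sum_congr rfl fun w _ => ?_
  obtain ⟨w, rfl⟩ := w
  exact mul_comm _ _

theorem sum_node_messages (s : S) (lam : M.Messages) (b : M.Beliefs) :
    ∑ v, ∑ z, b.1 s v z * ∑ α : M.Nbr v, lam s α.1 ⟨v, α.2⟩ z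
      = ∑ α, ∑ u : {v // v ∈ M.scope α}, ∑ z, lam s α u z * b.1 s u z := by
  rw [← M.sum_nbr_comm fun α u => ∑ z, lam s α u z * b.1 s u z]
  refine Finset.sum_congr rfl fun v _ => ?_
  simp_rw [Finset.mul_sum]
  rw [Finset.sum_comm]
  exact Finset.sum_congr rfl fun α _ => Finset.sum_congr rfl fun z _ => mul_comm _ _

/-- A message is subtracted at its node and added at its factor, so in the pairing with `b` it
cancels up to the violation of the marginalization constraint. -/
theorem sum_repar (lam : M.Messages) (θ : R → ℝ) (b : M.Beliefs) :
    ∑ s, ∑ v, ∑ z, b.1 s v z * M.reparV lam θ s v z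
      + ∑ s, ∑ α, ∑ z, b.2 s α z * M.reparA lam θ s α z
      = ∑ s, ∑ v, ∑ z, b.1 s v z * M.err (M.label s) v z + ∑ r, θ r * M.moment b r
        + M.slackPairing lam b := by
  have h1 : ∀ s, ∑ v, ∑ z, b.1 s v z * M.reparV lam θ s v z
      = ∑ v, ∑ z, b.1 s v z * M.err (M.label s) v z
        + ∑ r, θ r * ∑ v ∈ M.nodes r (M.input s), ∑ z, b.1 s v z * M.phiV r v (M.input s) z
        - ∑ α, ∑ u : {v // v ∈ M.scope α}, ∑ z, lam s α u z * b.1 s u z := fun s => by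
    rw [← sum_node_messages, ← sum_mul_sum_ite (fun r => M.nodes r (M.input s)) θ
      (fun r v z => M.phiV r v (M.input s) z), ← Finset.sum_add_distrib, ← Finset.sum_sub_distrib]
    refine Finset.sum_congr rfl fun v _ => ?_
    rw [← Finset.sum_add_distrib, ← Finset.sum_sub_distrib]
    refine Finset.sum_congr rfl fun z _ => ?_
    rw [reparV, potV, mul_sub, mul_add]
  have h2 : ∀ s, ∑ α, ∑ z, b.2 s α z * M.reparA lam θ s α z
      = ∑ r, θ r * ∑ α ∈ M.factors r (M.input s), ∑ z, b.2 s α z * M.phiA r α (M.input s) z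
        + ∑ α, ∑ u, ∑ z, lam s α u z * ∑ w : {w : M.FactorLabel α // w u = z}, b.2 s α w.1 :=
    fun s => by
    classical
    rw [← sum_factor_messages, ← sum_mul_sum_ite (fun r => M.factors r (M.input s)) θ
      (fun r α z => M.phiA r α (M.input s) z), ← Finset.sum_add_distrib]
    refine Finset.sum_congr rfl fun v _ => ?_
    rw [← Finset.sum_add_distrib]
    refine Finset.sum_congr rfl fun z _ => ?_
    rw [reparA, potA, mul_add]
  have h3 : ∑ r, θ r * M.moment b r
      = ∑ s, (∑ r, θ r * ∑ v ∈ M.nodes r (M.input s), ∑ z, b.1 s v z * M.phiV r v (M.input s) z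
        + ∑ r, θ r * ∑ α ∈ M.factors r (M.input s), ∑ z, b.2 s α z * M.phiA r α (M.input s) z) := by
    simp_rw [← Finset.sum_add_distrib, ← mul_add]
    rw [Finset.sum_comm]
    exact Finset.sum_congr rfl fun r _ => by rw [moment, Finset.mul_sum]
  have h4 : M.slackPairing lam b
      = ∑ s, (∑ α, ∑ u, ∑ z, lam s α u z * ∑ w : {w : M.FactorLabel α // w u = z}, b.2 s α w.1
        - ∑ α, ∑ u : {v // v ∈ M.scope α}, ∑ z, lam s α u z * b.1 s u z) := by
    simp_rw [slackPairing, slack, mul_sub, Finset.sum_sub_distrib]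
  simp_rw [h3, h4, h1, h2]
  rw [← Finset.sum_add_distrib, ← Finset.sum_add_distrib, ← Finset.sum_add_distrib]
  refine Finset.sum_congr rfl fun s _ => ?_
  ring

/-- The objective is the Lagrangian of the dual at `b` plus the total gap of `b`. -/
theorem objective_eq (lam : M.Messages) (θ : R → ℝ) (b : M.Beliefs) :
    M.objective lam θ = M.totalGap lam θ b + M.entropyPart b
      + ∑ r, ((M.moment b r - M.empirical r) * θ r + M.C / M.p * |θ r| ^ M.p)
      + M.slackPairing lam b := by
  have h := M.sum_repar lam θ b
  simp only [objective, totalGap, entropyPart, gap, Finset.sum_sub_distrib, Finset.sum_add_distrib,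
    sub_mul, mul_comm (M.moment b _), ← Finset.mul_sum]
  linarith

variable {M}

theorem slackPairing_sub (lam lam' : M.Messages) (b : M.Beliefs) :
    M.slackPairing (lam' - lam) b = M.slackPairing lam' b - M.slackPairing lam b := by
  simp [slackPairing, sub_mul, Finset.sum_sub_distrib]

theorem slackPairing_eq_zero {lam : M.Messages} {b : M.Beliefs} (hb : b ∈ M.dualFeasible) :
    M.slackPairing lam b = 0 := by
  have : ∀ s α u z, M.slack b s α u z = 0 := fun s α u z => by
    rw [slack, hb.2.2 s α u z, sub_self]
  simp [slackPairing, this]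

/-! ### Nonnegativity of the total gap and increments of the objective. -/

section Gap

variable [∀ v, Nonempty (Y v)]

theorem IsBeliefs.totalGap_eq_zero {lam : M.Messages} {θ : R → ℝ} {b : M.Beliefs}
    (hb : M.IsBeliefs lam θ b) : M.totalGap lam θ b = 0 := by
  simp only [totalGap, (hb.1 _ _).gap_eq_zero, (hb.2 _ _).gap_eq_zero, Finset.sum_const_zero,
    add_zero]

theorem exists_isBeliefs (lam : M.Messages) (θ : R → ℝ) : ∃ b, M.IsBeliefs lam θ b := by
  choose b₁ h₁ using fun s v => exists_isBelief (M.eps * M.cV v) (M.reparV lam θ s v)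
  choose b₂ h₂ using fun s α => exists_isBelief (M.eps * M.cA α) (M.reparA lam θ s α)
  exact ⟨(b₁, b₂), h₁, h₂⟩

/-- All beliefs are probability distributions. -/
def InSimplex (b : M.Beliefs) : Prop :=
  (∀ s v, b.1 s v ∈ stdSimplex ℝ (Y v)) ∧ ∀ s α, b.2 s α ∈ stdSimplex ℝ (M.FactorLabel α)

theorem IsBeliefs.inSimplex {lam : M.Messages} {θ : R → ℝ} {b : M.Beliefs}
    (hb : M.IsBeliefs lam θ b) : InSimplex b :=
  ⟨fun s v => (hb.1 s v).mem_stdSimplex, fun s α => (hb.2 s α).mem_stdSimplex⟩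

/-- The increment of the objective, seen from a point with beliefs `b`. -/
theorem IsBeliefs.objective_sub {lam lam' : M.Messages} {θ θ' : R → ℝ} {b : M.Beliefs}
    (hb : M.IsBeliefs lam θ b) :
    M.objective lam' θ' - M.objective lam θ = M.totalGap lam' θ' b
      + ∑ r, ((θ' r - θ r) * M.grad θ b r + M.C * bregman M.p (θ' r) (θ r))
      + M.slackPairing (lam' - lam) b := by
  rw [M.objective_eq lam' θ' b, M.objective_eq lam θ b, hb.totalGap_eq_zero, slackPairing_sub]
  -- The moments enter linearly; only the regularizer leaves a second-order remainder, its Bregman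
  -- divergence.
  have : ∑ r, ((θ' r - θ r) * M.grad θ b r + M.C * bregman M.p (θ' r) (θ r))
      = ∑ r, ((M.moment b r - M.empirical r) * θ' r + M.C / M.p * |θ' r| ^ M.p)
        - ∑ r, ((M.moment b r - M.empirical r) * θ r + M.C / M.p * |θ r| ^ M.p) := by
    rw [← Finset.sum_sub_distrib]
    refine Finset.sum_congr rfl fun r _ => ?_
    rw [grad, bregman, dpow]
    ring
  rw [this]
  ring

variable (hV : ∀ v, 0 ≤ M.eps * M.cV v) (hA : ∀ α, 0 ≤ M.eps * M.cA α)

include hV hA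

theorem gapV_le_totalGap {b : M.Beliefs} (hb : InSimplex b) (lam : M.Messages) (θ : R → ℝ)
    (s : S) (v : V) :
    gap (M.eps * M.cV v) (M.reparV lam θ s v) (b.1 s v) ≤ M.totalGap lam θ b := by
  have h1 : ∀ s v, 0 ≤ gap (M.eps * M.cV v) (M.reparV lam θ s v) (b.1 s v) := fun s v =>
    gap_nonneg (hV v) _ (hb.1 s v)
  have h2 : ∀ s α, 0 ≤ gap (M.eps * M.cA α) (M.reparA lam θ s α) (b.2 s α) := fun s α =>
    gap_nonneg (hA α) _ (hb.2 s α)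
  have h3 := Finset.single_le_sum (fun v _ => h1 s v) (Finset.mem_univ v)
  have h4 := Finset.single_le_sum (fun s _ => Finset.sum_nonneg (s := Finset.univ)
    fun v _ => h1 s v) (Finset.mem_univ s)
  have h5 := Finset.sum_nonneg fun s (_ : s ∈ Finset.univ) =>
    Finset.sum_nonneg fun α (_ : α ∈ Finset.univ) => h2 s α
  rw [totalGap]
  linarith

theorem gapA_le_totalGap {b : M.Beliefs} (hb : InSimplex b) (lam : M.Messages) (θ : R → ℝ)
    (s : S) (α : A) :
    gap (M.eps * M.cA α) (M.reparA lam θ s α) (b.2 s α) ≤ M.totalGap lam θ b := by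
  have h1 : ∀ s v, 0 ≤ gap (M.eps * M.cV v) (M.reparV lam θ s v) (b.1 s v) := fun s v =>
    gap_nonneg (hV v) _ (hb.1 s v)
  have h2 : ∀ s α, 0 ≤ gap (M.eps * M.cA α) (M.reparA lam θ s α) (b.2 s α) := fun s α =>
    gap_nonneg (hA α) _ (hb.2 s α)
  have h3 := Finset.single_le_sum (fun v _ => h2 s v) (Finset.mem_univ α)
  have h4 := Finset.single_le_sum (fun s _ => Finset.sum_nonneg (s := Finset.univ)
    fun v _ => h2 s v) (Finset.mem_univ s)
  have h5 := Finset.sum_nonneg fun s (_ : s ∈ Finset.univ) =>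
    Finset.sum_nonneg fun v (_ : v ∈ Finset.univ) => h1 s v
  rw [totalGap]
  linarith

theorem totalGap_nonneg {b : M.Beliefs} (hb : InSimplex b) (lam : M.Messages) (θ : R → ℝ) :
    0 ≤ M.totalGap lam θ b :=
  add_nonneg
    (Finset.sum_nonneg fun s _ => Finset.sum_nonneg fun v _ =>
      gap_nonneg (hV v) _ (hb.1 s v))
    (Finset.sum_nonneg fun s _ => Finset.sum_nonneg fun α _ =>
      gap_nonneg (hA α) _ (hb.2 s α))

end Gap

end Problem

namespace Problem

variable {V A R S X : Type*} {Y : V → Type*}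
  [Fintype V] [DecidableEq V] [Fintype A] [Fintype R] [DecidableEq R] [Fintype S]
  [∀ v, Fintype (Y v)] [∀ v, DecidableEq (Y v)] [∀ v, Nonempty (Y v)]
  {M : Problem V A R S X Y}

/-! ### Message updates -/

/-- On the fibre the message from `v` is a constant and leaves the soft-max. What remains is `mu`,
which does not involve that message. -/
theorem softMax_reparA_fiber (lam lam' : M.Messages) (θ : R → ℝ) (s : S) (α : A)
    (v : {v // v ∈ M.scope α}) (h : ∀ u, u ≠ v → lam' s α u = lam s α u) (z : Y v) :
    softMax (M.eps * M.cA α) (fun w : {w : M.FactorLabel α // w v = z} => M.reparA lam' θ s α w.1)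
      = M.mu lam θ s α v z + lam' s α v z := by
  have : Nonempty {w : M.FactorLabel α // w v = z} :=
    ⟨⟨Function.update (fun _ => Classical.arbitrary _) v z, by simp⟩⟩
  rw [mu, ← softMax_add_const]
  congr 1
  funext w
  rw [reparA, ← Finset.sum_erase_add _ _ (Finset.mem_univ v), w.2, add_assoc]
  congr 2
  exact Finset.sum_congr rfl fun u hu => by rw [h u (Finset.ne_of_mem_erase hu)]

theorem update_surjective (α : A) (v : {v // v ∈ M.scope α}) :
    Function.Surjective fun w : M.FactorLabel α => w v := fun z =>
  ⟨Function.update (fun _ => Classical.arbitrary _) v z, by simp⟩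

/-- After an update of the messages at `v`, there are beliefs that satisfy the marginalization
constraints at `v`. -/
theorem MessageUpdate.exists_isBeliefs (heps : 0 ≤ M.eps) (hcA : ∀ α, 0 ≤ M.cA α)
    (hcV : ∀ v, 0 ≤ M.cV v) {v : V} {lam lam' : M.Messages} {θ : R → ℝ}
    (hu : M.MessageUpdate v lam θ lam') :
    ∃ b, M.IsBeliefs lam' θ b ∧ ∀ s (α : M.Nbr v) z, M.slack b s α.1 ⟨v, α.2⟩ z = 0 := by
  obtain ⟨hsame, wV, wA, k, hwV, hwA, hw, hc, hupd⟩ := hu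
  set W := wV + ∑ α, wA α with hW
  set τ := M.eps * (M.cV v + ∑ α : M.Nbr v, M.cA α.1) with hτ
  have hsum : 0 ≤ ∑ α : M.Nbr v, M.cA α.1 := Finset.sum_nonneg fun α _ => hcA α.1
  have hτ0 : 0 ≤ τ := mul_nonneg heps (add_nonneg (hcV v) hsum)
  -- Each temperature around `v` is its weight's share of the total `τ`. If `τ = 0` all of them
  -- vanish, so arbitrary weights are admissible.
  have hscale : M.eps * M.cV v = wV / W * τ ∧ ∀ α : M.Nbr v, M.eps * M.cA α.1 = wA α / W * τ := by
    rcases hτ0.eq_or_lt with h | h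
    · rw [← h]
      simp only [mul_zero]
      have h1 : M.eps * M.cV v + ∑ α : M.Nbr v, M.eps * M.cA α.1 = 0 := by
        rw [← Finset.mul_sum, ← mul_add, ← hτ, h]
      have h2 : ∀ α ∈ (Finset.univ : Finset (M.Nbr v)), 0 ≤ M.eps * M.cA α.1 := fun α _ =>
        mul_nonneg heps (hcA α.1)
      have h3 := (add_eq_zero_iff_of_nonneg (mul_nonneg heps (hcV v)) (Finset.sum_nonneg h2)).1 h1
      exact ⟨h3.1, fun α => (Finset.sum_eq_zero_iff_of_nonneg h2).1 h3.2 α (Finset.mem_univ α)⟩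
    · obtain ⟨h1, h2⟩ := hc h
      have h3 : τ = M.eps * W := by
        rw [hτ, hW, h1]
        simp_rw [h2]
      rw [h3, h1]
      refine ⟨by field_simp, fun α => ?_⟩
      rw [h2]
      field_simp
  set Ψ : S → Y v → ℝ := fun s z =>
    M.potV θ s v z + ∑ β : M.Nbr v, M.mu lam θ s β.1 ⟨v, β.2⟩ z with hΨ
  -- The update makes the potential at `v`, and the fibrewise soft-max of every adjacent factor, a
  -- nonnegative multiple of the same `Ψ` plus a constant, with the temperature scaled by the same
  -- factor. Hence one `c` can be the belief at `v` and the marginal of all adjacent factor beliefs.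
  choose c hcb using fun s => exists_isBelief τ (Ψ s)
  have hV : ∀ s u, ∃ b, IsBelief (M.eps * M.cV u) (M.reparV lam' θ s u) b ∧
      ∀ h : u = v, ∀ z, b z = c s (h ▸ z) := by
    intro s u
    by_cases h : u = v
    · subst h
      refine ⟨c s, ?_, fun _ _ => rfl⟩
      rw [hscale.1]
      have := (hcb s).smul (div_nonneg hwV hw.le) (-∑ α, k s α)
      convert this using 1
      funext z
      rw [reparV, Finset.sum_congr rfl fun α _ => hupd s α z]
      rw [Finset.sum_add_distrib, Finset.sum_sub_distrib, ← Finset.sum_mul, ← Finset.sum_div]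
      -- After giving the factors their shares of `Ψ`, the node keeps exactly the share `wV / W`.
      have h1 : (∑ α, wA α) / W = 1 - wV / W := by
        rw [eq_sub_iff_add_eq, ← add_div, add_comm, div_self hw.ne']
      rw [h1]
      simp only [hΨ]
      ring
    · obtain ⟨b, hb⟩ := exists_isBelief (M.eps * M.cV u) (M.reparV lam' θ s u)
      exact ⟨b, hb, fun h' => absurd h' h⟩
  have hA : ∀ s α, ∃ b, IsBelief (M.eps * M.cA α) (M.reparA lam' θ s α) b ∧
      ∀ (h : v ∈ M.scope α) z,
        ∑ w : {w : M.FactorLabel α // w ⟨v, h⟩ = z}, b w.1 = c s z := by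
    intro s α
    by_cases h : v ∈ M.scope α
    · have hbel : IsBelief (M.eps * M.cA α) (fun z => softMax (M.eps * M.cA α)
          fun w : {w : M.FactorLabel α // w ⟨v, h⟩ = z} => M.reparA lam' θ s α w.1) (c s) := by
        have h1 := (hcb s).smul (div_nonneg (hwA ⟨α, h⟩) hw.le) (k s ⟨α, h⟩)
        rw [← hscale.2 ⟨α, h⟩] at h1
        convert h1 using 1
        funext z
        rw [softMax_reparA_fiber lam lam' θ s α ⟨v, h⟩ (fun u hu => hsame s α u fun h' =>
          hu (Subtype.ext h')), hupd s ⟨α, h⟩ z]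
        ring
      obtain ⟨b, hb, hb'⟩ := hbel.exists_lift (update_surjective α ⟨v, h⟩)
      exact ⟨b, hb, fun _ => hb'⟩
    · obtain ⟨b, hb⟩ := exists_isBelief (M.eps * M.cA α) (M.reparA lam' θ s α)
      exact ⟨b, hb, fun h' => absurd h' h⟩
  choose b₁ h₁ h₁' using hV
  choose b₂ h₂ h₂' using hA
  refine ⟨(b₁, b₂), ⟨h₁, h₂⟩, fun s α z => ?_⟩
  rw [slack, h₂' s α.1 α.2 z]
  exact sub_eq_zero.2 (h₁' s v rfl z).symm

theorem MessageUpdate.slackPairing_eq_zero {v : V} {lam lam' : M.Messages} {θ : R → ℝ}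
    (hu : M.MessageUpdate v lam θ lam') {b : M.Beliefs}
    (hb : ∀ s (α : M.Nbr v) z, M.slack b s α.1 ⟨v, α.2⟩ z = 0) :
    M.slackPairing (lam - lam') b = 0 := by
  refine Finset.sum_eq_zero fun s _ => Finset.sum_eq_zero fun α _ => Finset.sum_eq_zero fun u _ =>
    Finset.sum_eq_zero fun z _ => ?_
  by_cases h : u.1 = v
  · subst h
    rw [hb s ⟨α, u.2⟩ z, mul_zero]
  · simp only [Pi.sub_apply]
    rw [hu.1 s α u h, sub_self, zero_mul]

/-- The decrease of the objective in a message update. -/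
theorem MessageUpdate.objective_sub {v : V} {lam lam' : M.Messages} {θ : R → ℝ}
    (hu : M.MessageUpdate v lam θ lam') {b : M.Beliefs} (hbel : M.IsBeliefs lam' θ b)
    (hb : ∀ s (α : M.Nbr v) z, M.slack b s α.1 ⟨v, α.2⟩ z = 0) :
    M.objective lam θ - M.objective lam' θ = M.totalGap lam θ b := by
  rw [hbel.objective_sub, hu.slackPairing_eq_zero hb]
  simp [bregman]

/-! ### The uniform beliefs and a lower bound on the objective -/

variable (M) in
/-- The uniform beliefs. -/
def uniformBeliefs : M.Beliefs :=
  (fun _ v _ => (Fintype.card (Y v) : ℝ)⁻¹, fun _ α _ => (Fintype.card (M.FactorLabel α) : ℝ)⁻¹)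

theorem const_mem_stdSimplex (ι : Type*) [Fintype ι] [Nonempty ι] :
    (fun _ : ι => (Fintype.card ι : ℝ)⁻¹) ∈ stdSimplex ℝ ι :=
  ⟨fun _ => by positivity, by simp⟩

/-- Overwriting the coordinate `v` is injective on a fibre. Used both ways, this gives fibres of
equal size, hence uniform marginals of the uniform distribution. -/
theorem card_fiber_le (α : A) (v : {v // v ∈ M.scope α}) (z z' : Y v) :
    Fintype.card {w : M.FactorLabel α // w v = z} ≤ Fintype.card {w : M.FactorLabel α // w v = z'} := by
  refine Fintype.card_le_of_injective (fun w => ⟨Function.update w.1 v z', by simp⟩) ?_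
  intro w₁ w₂ h
  apply Subtype.ext
  funext u
  by_cases hu : u = v
  · subst hu
    rw [w₁.2, w₂.2]
  · have := congrFun (congrArg Subtype.val h) u
    simpa [Function.update_of_ne hu] using this

theorem uniformBeliefs_mem : M.uniformBeliefs ∈ M.dualFeasible := by
  refine ⟨fun s v => const_mem_stdSimplex (Y v), fun s α => const_mem_stdSimplex (M.FactorLabel α),
    fun s α v z => ?_⟩
  have h1 : ∑ z' : Y v, Fintype.card {w : M.FactorLabel α // w v = z'}
      = Fintype.card (M.FactorLabel α) := by
    rw [← Fintype.card_sigma]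
    exact Fintype.card_congr (Equiv.sigmaFiberEquiv fun w : M.FactorLabel α => w v)
  have h2 : ∀ z', Fintype.card {w : M.FactorLabel α // w v = z'}
      = Fintype.card {w : M.FactorLabel α // w v = z} := fun z' =>
    le_antisymm (card_fiber_le α v z' z) (card_fiber_le α v z z')
  simp only [h2, Finset.sum_const, Finset.card_univ, smul_eq_mul] at h1
  have h3 : (Fintype.card (Y v) : ℝ) * Fintype.card {w : M.FactorLabel α // w v = z}
      = Fintype.card (M.FactorLabel α) := by exact_mod_cast h1
  have h4 : (Fintype.card (Y v) : ℝ) ≠ 0 := Nat.cast_ne_zero.2 Fintype.card_ne_zero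
  have h5 : (Fintype.card (M.FactorLabel α) : ℝ) ≠ 0 := Nat.cast_ne_zero.2 Fintype.card_ne_zero
  simp only [uniformBeliefs, Finset.sum_const, Finset.card_univ, nsmul_eq_mul]
  rw [← div_eq_mul_inv, div_eq_iff h5, ← h3, inv_mul_cancel_left₀ h4]

/-- Weak duality, with the gap made explicit. -/
theorem dualObjective_add_totalGap_le {q : ℝ} (hpq : M.p.HolderConjugate q) (hC : 0 < M.C)
    {b : M.Beliefs} (hb : b ∈ M.dualFeasible) (lam : M.Messages) (θ : R → ℝ) :
    M.dualObjective q b + M.totalGap lam θ b ≤ M.objective lam θ := by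
  rw [M.objective_eq lam θ b, slackPairing_eq_zero hb, dualObjective, ← entropyPart, Finset.mul_sum]
  have : ∑ r, -(M.C ^ (1 - q) / q * |M.moment b r - M.empirical r| ^ q)
      ≤ ∑ r, ((M.moment b r - M.empirical r) * θ r + M.C / M.p * |θ r| ^ M.p) :=
    Finset.sum_le_sum fun r _ => neg_conj_le hpq hC _ _
  rw [Finset.sum_neg_distrib] at this
  linarith

/-- Evaluate the Lagrangian identity at the uniform beliefs, where the slack vanishes. Besides the
lower bound, this controls both `θ` and the gap of the uniform beliefs on sublevel sets. -/
theorem exists_le_objective {q : ℝ} (hpq : M.p.HolderConjugate q) (hC : 0 < M.C) :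
    ∃ K : ℝ, ∀ lam θ, M.totalGap lam θ M.uniformBeliefs + ∑ r, |θ r| - K ≤ M.objective lam θ := by
  set u := M.uniformBeliefs
  refine ⟨∑ r, M.C ^ (1 - q) / q * (|M.moment u r - M.empirical r| + 1) ^ q - M.entropyPart u,
    fun lam θ => ?_⟩
  rw [M.objective_eq lam θ u, slackPairing_eq_zero uniformBeliefs_mem]
  have := Finset.sum_le_sum fun r (_ : r ∈ Finset.univ) =>
    abs_sub_conj_le hpq hC (M.moment u r - M.empirical r) (θ r)
  rw [Finset.sum_sub_distrib] at this
  linarith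

/-! ### Monotonicity -/

section Monotone

variable {sched : ℕ → V ⊕ R} {lam : ℕ → M.Messages} {θ : ℕ → R → ℝ} {η : ℕ → ℝ} {b : ℕ → M.Beliefs}

theorem IsRun.antitone (heps : 0 ≤ M.eps) (hcA : ∀ α, 0 ≤ M.cA α) (hcV : ∀ v, 0 ≤ M.cV v)
    (hrun : M.IsRun sched lam θ η b) : Antitone fun t => M.objective (lam t) (θ t) := by
  refine antitone_nat_of_succ_le fun t => ?_
  rcases h : sched t with v | r
  · obtain ⟨hu, hθ⟩ := hrun.message_step t v h
    obtain ⟨b', hbel, hb'⟩ := hu.exists_isBeliefs heps hcA hcV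
    have h1 := hu.objective_sub hbel hb'
    have h2 := totalGap_nonneg (fun v => mul_nonneg heps (hcV v))
      (fun α => mul_nonneg heps (hcA α)) hbel.inSimplex (lam t) (θ t)
    rw [hθ]
    linarith
  · obtain ⟨hlam, -, -, hle⟩ := hrun.theta_step t r h
    rw [hlam]
    exact hle

theorem IsRun.exists_tendsto {q : ℝ} (hpq : M.p.HolderConjugate q) (hC : 0 < M.C)
    (heps : 0 ≤ M.eps) (hcA : ∀ α, 0 ≤ M.cA α) (hcV : ∀ v, 0 ≤ M.cV v)
    (hrun : M.IsRun sched lam θ η b) :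
    ∃ l : ℝ, Tendsto (fun t => M.objective (lam t) (θ t)) atTop (𝓝 l) := by
  obtain ⟨K, hK⟩ := exists_le_objective (M := M) hpq hC
  refine ⟨_, tendsto_atTop_ciInf (hrun.antitone heps hcA hcV) ⟨-K, ?_⟩⟩
  rintro _ ⟨t, rfl⟩
  have h1 := hK (lam t) (θ t)
  have h2 := totalGap_nonneg (fun v => mul_nonneg heps (hcV v))
    (fun α => mul_nonneg heps (hcA α)) (b := M.uniformBeliefs)
    ⟨uniformBeliefs_mem.1, uniformBeliefs_mem.2.1⟩ (lam t) (θ t)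
  have h3 : 0 ≤ ∑ r, |θ t r| := Finset.sum_nonneg fun r _ => abs_nonneg _
  linarith

end Monotone

end Problem

/-! ### Gap and oscillation of a potential. -/

theorem gap_add_const {ι : Type*} [Fintype ι] [Nonempty ι] (τ : ℝ) (f : ι → ℝ) {b : ι → ℝ}
    (hb : ∑ i, b i = 1) (k : ℝ) : gap τ (fun i => f i + k) b = gap τ f b := by
  rw [gap, gap, softMax_add_const]
  simp_rw [mul_add]
  rw [Finset.sum_add_distrib, ← Finset.sum_mul, hb]
  ring

/-- The oscillation of a potential is controlled by the gap of the uniform distribution. -/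
theorem abs_sub_le_gap {ι : Type*} [Fintype ι] [Nonempty ι] {τ : ℝ} (hτ : 0 < τ) (f : ι → ℝ)
    (i j : ι) :
    |f i - f j| ≤ Fintype.card ι * (gap τ f (fun _ => (Fintype.card ι : ℝ)⁻¹)
      + τ * entropy fun _ : ι => (Fintype.card ι : ℝ)⁻¹) := by
  obtain ⟨b, hb⟩ := exists_isBelief τ f
  have hs := hb.mem_stdSimplex
  have hcard : (0 : ℝ) < Fintype.card ι := by exact_mod_cast Fintype.card_pos
  have hu := Problem.const_mem_stdSimplex ι
  set u : ι → ℝ := fun _ => (Fintype.card ι : ℝ)⁻¹ with hu'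
  -- The number `-(τ log (b i))` is `softMax τ f - f i`; a bound on it for all `i` bounds the
  -- oscillation of `f`.
  have h : ∀ i, 0 ≤ -(τ * Real.log (b i)) ∧
      -(τ * Real.log (b i)) ≤ Fintype.card ι * (gap τ f u + τ * entropy u) := fun i => by
    have h1 := mul_le_mul_of_nonneg_left (mul_neg_log_le_gap hτ hu hb i) hcard.le
    have h2 : (Fintype.card ι : ℝ) * (τ * (u i * -Real.log (b i))) = -(τ * Real.log (b i)) := by
      rw [hu']
      field_simp
    refine ⟨?_, h2 ▸ h1⟩
    have hle : b i ≤ 1 := by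
      rw [← hs.2]
      exact Finset.single_le_sum (fun j _ => hs.1 j) (Finset.mem_univ i)
    have := mul_nonneg hτ.le (neg_nonneg.2 (Real.log_nonpos (hs.1 i) hle))
    linarith
  rw [hb.apply_eq hτ.ne' i, hb.apply_eq hτ.ne' j, abs_le]
  have := h i
  have := h j
  constructor <;> linarith

namespace Problem

variable {V A R S X : Type*} {Y : V → Type*}
  [Fintype V] [DecidableEq V] [Fintype A] [Fintype R] [DecidableEq R] [Fintype S]
  [∀ v, Fintype (Y v)] [∀ v, DecidableEq (Y v)] [∀ v, Nonempty (Y v)]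
  {M : Problem V A R S X Y}

/-! ### Gibbs beliefs and continuity -/

/-- The Gibbs beliefs at `(lam, θ)`. -/
def gibbs (lam : M.Messages) (θ : R → ℝ) : M.Beliefs :=
  (fun s v z => Real.exp (M.reparV lam θ s v z / (M.eps * M.cV v))
      / ∑ z', Real.exp (M.reparV lam θ s v z' / (M.eps * M.cV v)),
    fun s α z => Real.exp (M.reparA lam θ s α z / (M.eps * M.cA α))
      / ∑ z', Real.exp (M.reparA lam θ s α z' / (M.eps * M.cA α)))

theorem continuous_potV (s : S) (v : V) (z : Y v) :
    Continuous fun θ : R → ℝ => M.potV θ s v z := by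
  unfold potV
  refine continuous_const.add (continuous_finsetSum _ fun r _ => ?_)
  split_ifs
  · fun_prop
  · fun_prop

theorem continuous_potA (s : S) (α : A) (z : M.FactorLabel α) :
    Continuous fun θ : R → ℝ => M.potA θ s α z := by
  unfold potA
  refine continuous_finsetSum _ fun r _ => ?_
  split_ifs
  · fun_prop
  · fun_prop

theorem continuous_reparV (s : S) (v : V) (z : Y v) :
    Continuous fun x : M.Messages × (R → ℝ) => M.reparV x.1 x.2 s v z := by
  unfold reparV
  exact ((continuous_potV s v z).comp continuous_snd).sub (by fun_prop)

theorem continuous_reparA (s : S) (α : A) (z : M.FactorLabel α) :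
    Continuous fun x : M.Messages × (R → ℝ) => M.reparA x.1 x.2 s α z := by
  unfold reparA
  exact ((continuous_potA s α z).comp continuous_snd).add (by fun_prop)

theorem continuous_gibbs : Continuous fun x : M.Messages × (R → ℝ) => gibbs x.1 x.2 := by
  unfold gibbs
  refine Continuous.prodMk ?_ ?_
  · refine continuous_pi fun s => continuous_pi fun v => continuous_pi fun z => ?_
    have h := fun z => (continuous_reparV (M := M) s v z).div_const (M.eps * M.cV v)
    exact (Real.continuous_exp.comp (h z)).div
      (continuous_finsetSum _ fun z' _ => Real.continuous_exp.comp (h z'))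
      fun x => (sum_exp_pos fun z => M.reparV x.1 x.2 s v z / (M.eps * M.cV v)).ne'
  · refine continuous_pi fun s => continuous_pi fun α => continuous_pi fun z => ?_
    have h := fun z => (continuous_reparA (M := M) s α z).div_const (M.eps * M.cA α)
    exact (Real.continuous_exp.comp (h z)).div
      (continuous_finsetSum _ fun z' _ => Real.continuous_exp.comp (h z'))
      fun x => (sum_exp_pos fun z => M.reparA x.1 x.2 s α z / (M.eps * M.cA α)).ne'

theorem continuous_moment (r : R) : Continuous fun b : M.Beliefs => M.moment b r := by
  unfold moment
  fun_prop

theorem continuous_slack (s : S) (α : A) (u : {v // v ∈ M.scope α}) (z : Y u) :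
    Continuous fun b : M.Beliefs => M.slack b s α u z := by
  unfold slack
  fun_prop

theorem continuous_grad (hp : 1 < M.p) (r : R) :
    Continuous fun x : (R → ℝ) × M.Beliefs => M.grad x.1 x.2 r := by
  have h : (fun x : (R → ℝ) × M.Beliefs => M.grad x.1 x.2 r)
      = fun x => M.moment x.2 r - M.empirical r + M.C * dpow M.p (x.1 r) := by
    funext x
    rw [grad, dpow, mul_assoc]
  rw [h]
  exact (((continuous_moment r).comp continuous_snd).sub continuous_const).add
    (continuous_const.mul ((continuous_dpow hp).comp ((continuous_apply r).comp continuous_fst)))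

variable (M) in
/-- All temperatures are positive. -/
def PosTemp : Prop := (∀ v, 0 < M.eps * M.cV v) ∧ ∀ α, 0 < M.eps * M.cA α

theorem PosTemp.isBeliefs_iff (hM : M.PosTemp) {lam : M.Messages} {θ : R → ℝ} {b : M.Beliefs} :
    M.IsBeliefs lam θ b ↔ b = gibbs lam θ := by
  have hV := fun v => (hM.1 v).ne'
  have hA := fun α => (hM.2 α).ne'
  constructor
  · rintro ⟨h1, h2⟩
    refine Prod.ext ?_ ?_
    · funext s v z
      exact (isBelief_of_ne (hV v)).1 (h1 s v) z
    · funext s α z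
      exact (isBelief_of_ne (hA α)).1 (h2 s α) z
  · rintro rfl
    exact ⟨fun s v => (isBelief_of_ne (hV v)).2 fun _ => rfl,
      fun s α => (isBelief_of_ne (hA α)).2 fun _ => rfl⟩

theorem PosTemp.isBeliefs_gibbs (hM : M.PosTemp) (lam : M.Messages) (θ : R → ℝ) :
    M.IsBeliefs lam θ (gibbs lam θ) := hM.isBeliefs_iff.2 rfl

theorem PosTemp.continuous_objective (hM : M.PosTemp) (hp : 1 < M.p) :
    Continuous fun x : M.Messages × (R → ℝ) => M.objective x.1 x.2 := by
  unfold objective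
  refine (((continuous_finsetSum _ fun s _ => continuous_finsetSum _ fun v _ =>
    (continuous_softMax (hM.1 v).ne').comp (continuous_pi fun z => continuous_reparV s v z)).add
    (continuous_finsetSum _ fun s _ => continuous_finsetSum _ fun α _ =>
    (continuous_softMax (hM.2 α).ne').comp (continuous_pi fun z => continuous_reparA s α z))).sub
    (by fun_prop)).add (continuous_const.mul (continuous_finsetSum _ fun r _ => ?_))
  exact (continuous_abs.comp ((continuous_apply r).comp continuous_snd)).rpow_const
    fun x => Or.inr (by linarith)

theorem PosTemp.totalGap_nonneg (hM : M.PosTemp) {b : M.Beliefs} (hb : InSimplex b)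
    (lam : M.Messages) (θ : R → ℝ) : 0 ≤ M.totalGap lam θ b :=
  Problem.totalGap_nonneg (fun v => (hM.1 v).le) (fun α => (hM.2 α).le) hb lam θ

/-- The gradient inequality. -/
theorem PosTemp.le_objective_sub (hM : M.PosTemp) (hp : 1 < M.p) (hC : 0 < M.C)
    {lam lam' : M.Messages} {θ θ' : R → ℝ} {b : M.Beliefs} (hb : M.IsBeliefs lam θ b) :
    ∑ r, (θ' r - θ r) * M.grad θ b r + M.slackPairing (lam' - lam) b
      ≤ M.objective lam' θ' - M.objective lam θ := by
  rw [hb.objective_sub, Finset.sum_add_distrib]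
  have h1 := hM.totalGap_nonneg hb.inSimplex lam' θ'
  have h2 : 0 ≤ ∑ r, M.C * bregman M.p (θ' r) (θ r) :=
    Finset.sum_nonneg fun r _ => mul_nonneg hC.le (bregman_nonneg hp _ _)
  linarith

/-! ### Normalization of the messages -/

variable (M) in
/-- The differences of the contributions of the messages to the potentials. -/
def msgDiff : M.Messages →ₗ[ℝ] (S → (v : V) → Y v → Y v → ℝ) ×
    (S → (α : A) → M.FactorLabel α → M.FactorLabel α → ℝ) where
  toFun lam := (fun s v z z' => ∑ α : M.Nbr v, lam s α.1 ⟨v, α.2⟩ z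
      - ∑ α : M.Nbr v, lam s α.1 ⟨v, α.2⟩ z',
    fun s α w w' => ∑ v, lam s α v (w v) - ∑ v, lam s α v (w' v))
  map_add' x y := by
    refine Prod.ext ?_ ?_
    · funext s v z z'
      simp only [Pi.add_apply, Prod.fst_add, Finset.sum_add_distrib]
      ring
    · funext s v z z'
      simp only [Pi.add_apply, Prod.snd_add, Finset.sum_add_distrib]
      ring
  map_smul' c x := by
    refine Prod.ext ?_ ?_
    · funext s v z z'
      simp only [Pi.smul_apply, Prod.smul_fst, smul_eq_mul, ← Finset.mul_sum, RingHom.id_apply]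
      ring
    · funext s v z z'
      simp only [Pi.smul_apply, Prod.smul_snd, smul_eq_mul, ← Finset.mul_sum, RingHom.id_apply]
      ring

theorem abs_sum_ite_le {θ : R → ℝ} {B : ℝ} (hθ : ∑ r, |θ r| ≤ B) (P : R → Prop) [DecidablePred P]
    (φ : R → ℝ) : |∑ r, if P r then θ r * φ r else 0| ≤ B * ∑ r, |φ r| := by
  have hB : ∀ r, |θ r| ≤ B := fun r =>
    (Finset.single_le_sum (f := fun r => |θ r|) (fun _ _ => abs_nonneg _) (Finset.mem_univ r)).trans hθ
  refine (Finset.abs_sum_le_sum_abs _ _).trans ?_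
  rw [Finset.mul_sum]
  refine Finset.sum_le_sum fun r _ => ?_
  have h := mul_le_mul_of_nonneg_right (hB r) (abs_nonneg (φ r))
  split_ifs
  · rwa [abs_mul]
  · rw [abs_zero]
    exact (mul_nonneg (abs_nonneg _) (abs_nonneg _)).trans h

/-- On a sublevel set `θ` and the gap of the uniform beliefs are bounded. The latter bounds the
oscillation of every reparametrized potential, and removing the original potentials, bounded through
`θ`, leaves the contribution of the messages. -/
theorem PosTemp.exists_norm_msgDiff_le (hM : M.PosTemp) {q : ℝ} (hpq : M.p.HolderConjugate q)
    (hC : 0 < M.C) (c : ℝ) :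
    ∃ B D : ℝ, 0 ≤ D ∧ ∀ lam θ, M.objective lam θ ≤ c →
      ∑ r, |θ r| ≤ B ∧ ‖M.msgDiff lam‖ ≤ D := by
  obtain ⟨K, hK⟩ := exists_le_objective (M := M) hpq hC
  have hu : InSimplex M.uniformBeliefs := ⟨uniformBeliefs_mem.1, uniformBeliefs_mem.2.1⟩
  have hgap : ∀ lam θ, M.objective lam θ ≤ c →
      ∑ r, |θ r| ≤ c + K ∧ M.totalGap lam θ M.uniformBeliefs ≤ c + K := fun lam θ h => by
    have h1 := hK lam θ
    have h2 := hM.totalGap_nonneg hu lam θ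
    have h3 : 0 ≤ ∑ r, |θ r| := Finset.sum_nonneg fun r _ => abs_nonneg _
    constructor <;> linarith
  have hDV : ∃ D : ℝ, ∀ i : S × (Σ v, Y v × Y v), ∀ lam θ, M.objective lam θ ≤ c →
      |(M.msgDiff lam).1 i.1 i.2.1 i.2.2.1 i.2.2.2| ≤ D := by
    have : ∀ i : S × (Σ v, Y v × Y v), ∃ D : ℝ, ∀ lam θ, M.objective lam θ ≤ c →
        |(M.msgDiff lam).1 i.1 i.2.1 i.2.2.1 i.2.2.2| ≤ D := by
      rintro ⟨s, v, z, z'⟩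
      refine ⟨Fintype.card (Y v) * (c + K + M.eps * M.cV v * entropy (M.uniformBeliefs.1 s v))
        + ((|M.err (M.label s) v z| + (c + K) * ∑ r, |M.phiV r v (M.input s) z|)
        + (|M.err (M.label s) v z'| + (c + K) * ∑ r, |M.phiV r v (M.input s) z'|)),
        fun lam θ h => ?_⟩
      have h1 := abs_sub_le_gap (hM.1 v) (M.reparV lam θ s v) z z'
      have h2 := gapV_le_totalGap (fun v => (hM.1 v).le) (fun α => (hM.2 α).le) hu lam θ s v
      have h3 := hgap lam θ h
      have hpot : ∀ z, |M.potV θ s v z|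
          ≤ |M.err (M.label s) v z| + (c + K) * ∑ r, |M.phiV r v (M.input s) z| := fun z =>
        (abs_add_le _ _).trans (add_le_add_right (abs_sum_ite_le h3.1 _ _) _)
      have h4 : (M.msgDiff lam).1 s v z z' = -(M.reparV lam θ s v z - M.reparV lam θ s v z')
          + (M.potV θ s v z - M.potV θ s v z') := by
        simp only [msgDiff, reparV, LinearMap.coe_mk, AddHom.coe_mk]
        ring
      dsimp only
      rw [h4]
      refine (abs_add_le _ _).trans (add_le_add ?_ ((abs_sub _ _).trans
        (add_le_add (hpot z) (hpot z'))))
      rw [abs_neg]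
      refine h1.trans (mul_le_mul_of_nonneg_left (add_le_add_left (h2.trans h3.2) _) ?_)
      positivity
    choose D hD using this
    obtain ⟨D', hD'⟩ := Finite.exists_le D
    exact ⟨D', fun i lam θ h => (hD i lam θ h).trans (hD' i)⟩
  have hDA : ∃ D : ℝ, ∀ i : S × (Σ α, M.FactorLabel α × M.FactorLabel α), ∀ lam θ,
      M.objective lam θ ≤ c → |(M.msgDiff lam).2 i.1 i.2.1 i.2.2.1 i.2.2.2| ≤ D := by
    have : ∀ i : S × (Σ α, M.FactorLabel α × M.FactorLabel α), ∃ D : ℝ, ∀ lam θ,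
        M.objective lam θ ≤ c → |(M.msgDiff lam).2 i.1 i.2.1 i.2.2.1 i.2.2.2| ≤ D := by
      rintro ⟨s, v, z, z'⟩
      refine ⟨Fintype.card (M.FactorLabel v) *
        (c + K + M.eps * M.cA v * entropy (M.uniformBeliefs.2 s v))
        + ((c + K) * ∑ r, |M.phiA r v (M.input s) z| + (c + K) * ∑ r, |M.phiA r v (M.input s) z'|),
        fun lam θ h => ?_⟩
      have h1 := abs_sub_le_gap (hM.2 v) (M.reparA lam θ s v) z z'
      have h2 := gapA_le_totalGap (fun v => (hM.1 v).le) (fun α => (hM.2 α).le) hu lam θ s v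
      have h3 := hgap lam θ h
      have hpot : ∀ z, |M.potA θ s v z| ≤ (c + K) * ∑ r, |M.phiA r v (M.input s) z| := fun z =>
        by
        classical exact abs_sum_ite_le h3.1 _ _
      have h4 : (M.msgDiff lam).2 s v z z' = (M.reparA lam θ s v z - M.reparA lam θ s v z')
          - (M.potA θ s v z - M.potA θ s v z') := by
        simp only [msgDiff, reparA, LinearMap.coe_mk, AddHom.coe_mk]
        ring
      dsimp only
      rw [h4]
      refine (abs_sub _ _).trans (add_le_add ?_ ((abs_sub _ _).trans
        (add_le_add (hpot z) (hpot z'))))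
      refine h1.trans (mul_le_mul_of_nonneg_left (add_le_add_left (h2.trans h3.2) _) ?_)
      positivity
    choose D hD using this
    obtain ⟨D', hD'⟩ := Finite.exists_le D
    exact ⟨D', fun i lam θ h => (hD i lam θ h).trans (hD' i)⟩
  obtain ⟨D₁, h₁⟩ := hDV
  obtain ⟨D₂, h₂⟩ := hDA
  refine ⟨c + K, max 0 (max D₁ D₂), le_max_left _ _, fun lam θ h => ⟨(hgap lam θ h).1, ?_⟩⟩
  have h0 : 0 ≤ max 0 (max D₁ D₂) := le_max_left _ _
  rw [Prod.norm_def, max_le_iff]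
  simp only [pi_norm_le_iff_of_nonneg h0, Real.norm_eq_abs]
  exact ⟨fun s v z z' => (h₁ (s, ⟨v, z, z'⟩) lam θ h).trans
      ((le_max_left _ _).trans (le_max_right _ _)),
    fun s v z z' => (h₂ (s, ⟨v, z, z'⟩) lam θ h).trans
      ((le_max_right _ _).trans (le_max_right _ _))⟩

/-- Messages with the same differences give the same objective and the same beliefs. -/
theorem objective_congr_of_msgDiff {lam lam' : M.Messages} (h : M.msgDiff lam' = M.msgDiff lam)
    (θ : R → ℝ) : M.objective lam' θ = M.objective lam θ ∧
      ∀ b, M.IsBeliefs lam θ b → M.IsBeliefs lam' θ b := by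
  have hV : ∀ s v, ∃ k, ∀ z, M.reparV lam' θ s v z = M.reparV lam θ s v z + k := fun s v => by
    set z₀ := Classical.arbitrary (Y v)
    refine ⟨M.reparV lam' θ s v z₀ - M.reparV lam θ s v z₀, fun z => ?_⟩
    have := congrFun (congrFun (congrFun (congrFun (congrArg Prod.fst h) s) v) z) z₀
    simp only [msgDiff, LinearMap.coe_mk, AddHom.coe_mk] at this
    simp only [reparV]
    linarith
  have hA : ∀ s α, ∃ k, ∀ z, M.reparA lam' θ s α z = M.reparA lam θ s α z + k := fun s v => by
    set z₀ := Classical.arbitrary (M.FactorLabel v)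
    refine ⟨M.reparA lam' θ s v z₀ - M.reparA lam θ s v z₀, fun z => ?_⟩
    have := congrFun (congrFun (congrFun (congrFun (congrArg Prod.snd h) s) v) z) z₀
    simp only [msgDiff, LinearMap.coe_mk, AddHom.coe_mk] at this
    simp only [reparA]
    linarith
  choose kV hkV using hV
  choose kA hkA using hA
  constructor
  -- At the feasible uniform beliefs the messages enter the Lagrangian identity only through gaps,
  -- which ignore additive constants.
  · have hu := uniformBeliefs_mem (M := M)
    rw [M.objective_eq lam' θ M.uniformBeliefs, M.objective_eq lam θ M.uniformBeliefs,
      slackPairing_eq_zero hu, slackPairing_eq_zero hu]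
    have : M.totalGap lam' θ M.uniformBeliefs = M.totalGap lam θ M.uniformBeliefs := by
      rw [totalGap, totalGap]
      congr 1
      · refine Finset.sum_congr rfl fun s _ => Finset.sum_congr rfl fun v _ => ?_
        rw [funext (hkV s v), gap_add_const _ _ (hu.1 s v).2]
      · refine Finset.sum_congr rfl fun s _ => Finset.sum_congr rfl fun v _ => ?_
        rw [funext (hkA s v), gap_add_const _ _ (hu.2.1 s v).2]
    rw [this]
  · exact fun b hb => ⟨fun s v => (hb.1 s v).add_const _ (hkV s v),
      fun s α => (hb.2 s α).add_const _ (hkA s α)⟩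

/-- On a sublevel set of the objective, the messages can be normalized so as to be bounded. -/
theorem PosTemp.exists_normalization (hM : M.PosTemp) {q : ℝ} (hpq : M.p.HolderConjugate q)
    (hC : 0 < M.C) (c : ℝ) :
    ∃ B : ℝ, ∀ lam θ, M.objective lam θ ≤ c → (∑ r, |θ r| ≤ B) ∧ ∃ lam' : M.Messages,
      ‖lam'‖ ≤ B ∧ M.objective lam' θ = M.objective lam θ ∧
        ∀ b, M.IsBeliefs lam θ b → M.IsBeliefs lam' θ b := by
  obtain ⟨B, D, hD, h⟩ := hM.exists_norm_msgDiff_le hpq hC c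
  -- A linear section of `msgDiff` over its range is continuous in finite dimension. It picks, for
  -- given differences, messages whose norm is bounded by that of the differences.
  obtain ⟨Q, hQ⟩ := M.msgDiff.rangeRestrict.exists_rightInverse_of_surjective
    M.msgDiff.range_rangeRestrict
  set Q' := LinearMap.toContinuousLinearMap Q
  refine ⟨max B (‖Q'‖ * D), fun lam θ hle => ⟨(h lam θ hle).1.trans (le_max_left _ _),
    Q (M.msgDiff.rangeRestrict lam), ?_, objective_congr_of_msgDiff ?_ θ⟩⟩
  · refine ((Q'.le_opNorm (M.msgDiff.rangeRestrict lam)).trans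
      (mul_le_mul_of_nonneg_left ?_ (norm_nonneg _))).trans (le_max_right _ _)
    exact (h lam θ hle).2
  · have := LinearMap.congr_fun hQ (M.msgDiff.rangeRestrict lam)
    exact congrArg Subtype.val this

/-- Every point below the level `M.objective 0 0` has a representative of equal objective in a fixed
ball, so minimizing over that compact ball suffices. -/
theorem PosTemp.exists_isLeast (hM : M.PosTemp) {q : ℝ} (hpq : M.p.HolderConjugate q)
    (hC : 0 < M.C) : ∃ lam θ, ∀ lam' θ', M.objective lam θ ≤ M.objective lam' θ' := by
  obtain ⟨B, hB⟩ := hM.exists_normalization hpq hC (M.objective 0 0)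
  obtain ⟨x, -, hmin⟩ := (isCompact_closedBall (0 : M.Messages × (R → ℝ)) (max B 0)).exists_isMinOn
    ⟨0, by simp⟩ (hM.continuous_objective hpq.lt).continuousOn
  refine ⟨x.1, x.2, fun lam' θ' => ?_⟩
  rcases le_total (M.objective lam' θ') (M.objective 0 0) with hle | hle
  · obtain ⟨hθ, lam, hlam, heq, -⟩ := hB lam' θ' hle
    rw [← heq]
    refine hmin (a := (lam, θ')) ?_
    rw [mem_closedBall_zero_iff, Prod.norm_def, max_le_iff]
    refine ⟨hlam.trans (le_max_left _ _), (pi_norm_le_iff_of_nonneg (le_max_right _ _)).2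
      fun r => le_trans ?_ (hθ.trans (le_max_left _ _))⟩
    exact Finset.single_le_sum (f := fun r => |θ' r|) (fun _ _ => abs_nonneg _) (Finset.mem_univ r)
  · exact (hmin (a := 0) (by simp)).trans hle

/-- At a minimizer of the objective the beliefs are feasible and the gradient vanishes. -/
theorem PosTemp.stationary (hM : M.PosTemp) (hp : 1 < M.p) (hC : 0 < M.C)
    {lam : M.Messages} {θ : R → ℝ}
    (hmin : ∀ lam' θ', M.objective lam θ ≤ M.objective lam' θ') :
    (∀ s α u z, M.slack (gibbs lam θ) s α u z = 0) ∧ ∀ r, M.grad θ (gibbs lam θ) r = 0 := by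
  set b := gibbs lam θ
  set d : M.Messages := fun s α u z => -M.slack b s α u z with hd
  set e : R → ℝ := fun r => -M.grad θ b r with he
  -- This plays the role of the derivative of the objective along the steepest descent direction
  -- `(d, e)`.
  set ψ : ℝ → ℝ := fun t => ∑ r, e r * M.grad (θ + t • e) (gibbs (lam + t • d) (θ + t • e)) r
    + M.slackPairing d (gibbs (lam + t • d) (θ + t • e)) with hψ
  have hcont : Continuous ψ := by
    have hg : Continuous fun t : ℝ => gibbs (lam + t • d) (θ + t • e) :=
      continuous_gibbs.comp (f := fun t : ℝ => (lam + t • d, θ + t • e)) (by fun_prop)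
    refine Continuous.add (continuous_finsetSum _ fun r _ => continuous_const.mul
      ((continuous_grad hp r).comp (f := fun t : ℝ => (θ + t • e,
        gibbs (lam + t • d) (θ + t • e))) (Continuous.prodMk (by fun_prop) hg))) ?_
    unfold slackPairing
    exact continuous_finsetSum _ fun s _ => continuous_finsetSum _ fun α _ =>
      continuous_finsetSum _ fun u _ => continuous_finsetSum _ fun z _ =>
        continuous_const.mul ((continuous_slack s α u z).comp hg)
  -- The gradient inequality from the displaced point back to the minimizer reads `-t * ψ t ≤ F(min)
  -- - F(displaced) ≤ 0`. Letting `t → 0`, the sum of squares `-ψ 0` is at most zero.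
  have hpos : ∀ t > 0, 0 ≤ ψ t := by
    intro t ht
    have h1 := hM.le_objective_sub hp hC (lam' := lam) (θ' := θ)
      (hM.isBeliefs_gibbs (lam + t • d) (θ + t • e))
    have h2 := hmin (lam + t • d) (θ + t • e)
    have h3 : t * -ψ t = ∑ r, (θ r - (θ + t • e) r)
          * M.grad (θ + t • e) (gibbs (lam + t • d) (θ + t • e)) r
        + M.slackPairing (lam - (lam + t • d)) (gibbs (lam + t • d) (θ + t • e)) := by
      simp only [hψ, slackPairing, mul_neg, mul_add, Finset.mul_sum, Pi.add_apply, Pi.smul_apply,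
        Pi.sub_apply, smul_eq_mul, neg_add, ← Finset.sum_neg_distrib]
      congr 1
      · exact Finset.sum_congr rfl fun r _ => by ring
      · refine Finset.sum_congr rfl fun s _ => Finset.sum_congr rfl fun α _ =>
          Finset.sum_congr rfl fun u _ => Finset.sum_congr rfl fun z _ => ?_
        generalize M.slack _ s α u z = y
        ring
    by_contra hneg
    have := mul_pos ht (neg_pos.2 (not_le.1 hneg))
    linarith
  have h0 : 0 ≤ ψ 0 := by
    have h1 : Tendsto ψ (𝓝[>] 0) (𝓝 (ψ 0)) := hcont.continuousAt.tendsto.mono_left nhdsWithin_le_nhds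
    exact ge_of_tendsto h1 (eventually_nhdsWithin_of_forall hpos)
  have h1 : ψ 0 = -(∑ r, M.grad θ b r ^ 2 + ∑ s, ∑ α, ∑ u, ∑ z, M.slack b s α u z ^ 2) := by
    simp only [hψ, zero_smul, add_zero, slackPairing, hd, he, neg_add, ← Finset.sum_neg_distrib]
    congr 1
    · exact Finset.sum_congr rfl fun r _ => by ring
    · refine Finset.sum_congr rfl fun s _ => Finset.sum_congr rfl fun α _ =>
        Finset.sum_congr rfl fun u _ => Finset.sum_congr rfl fun z _ => ?_
      generalize M.slack _ s α u z = y
      ring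
  have n1 : 0 ≤ ∑ r, M.grad θ b r ^ 2 := Finset.sum_nonneg fun r _ => sq_nonneg _
  have n2 : ∀ s α u, 0 ≤ ∑ z, M.slack b s α u z ^ 2 := fun s α u =>
    Finset.sum_nonneg fun r _ => sq_nonneg _
  have n3 : ∀ s α, 0 ≤ ∑ u, ∑ z, M.slack b s α u z ^ 2 := fun s α =>
    Finset.sum_nonneg fun u _ => n2 s α u
  have n4 : ∀ s, 0 ≤ ∑ α, ∑ u, ∑ z, M.slack b s α u z ^ 2 := fun s =>
    Finset.sum_nonneg fun α _ => n3 s α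
  have n5 : 0 ≤ ∑ s, ∑ α, ∑ u, ∑ z, M.slack b s α u z ^ 2 := Finset.sum_nonneg fun s _ => n4 s
  have z1 : ∑ r, M.grad θ b r ^ 2 = 0 := by linarith
  have z2 : ∑ s, ∑ α, ∑ u, ∑ z, M.slack b s α u z ^ 2 = 0 := by linarith
  refine ⟨fun s α u z => ?_, fun r => ?_⟩
  · have e1 := (Finset.sum_eq_zero_iff_of_nonneg fun s _ => n4 s).1 z2 s (Finset.mem_univ s)
    have e2 := (Finset.sum_eq_zero_iff_of_nonneg fun α _ => n3 s α).1 e1 α (Finset.mem_univ α)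
    have e3 := (Finset.sum_eq_zero_iff_of_nonneg fun u _ => n2 s α u).1 e2 u (Finset.mem_univ u)
    have e4 := (Finset.sum_eq_zero_iff_of_nonneg fun z _ => sq_nonneg _).1 e3 z (Finset.mem_univ z)
    exact pow_eq_zero_iff two_ne_zero |>.1 e4
  · exact pow_eq_zero_iff two_ne_zero |>.1
      ((Finset.sum_eq_zero_iff_of_nonneg fun r _ => sq_nonneg _).1 z1 r (Finset.mem_univ r))

end Problem

/-! ### Concavity of the entropy. -/

theorem le_entropy_combo {ι : Type*} [Fintype ι] {x y : ι → ℝ} (hx : ∀ i, 0 ≤ x i)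
    (hy : ∀ i, 0 ≤ y i) {a c : ℝ} (ha : 0 ≤ a) (hc : 0 ≤ c) (hac : a + c = 1) :
    a * entropy x + c * entropy y ≤ entropy (a • x + c • y) := by
  rw [entropy, entropy, entropy, Finset.mul_sum, Finset.mul_sum, ← Finset.sum_add_distrib]
  exact Finset.sum_le_sum fun i _ => Real.concaveOn_negMulLog.2 (hx i) (hy i) ha hc hac

theorem lt_entropy_combo {ι : Type*} [Fintype ι] {x y : ι → ℝ} (hx : ∀ i, 0 ≤ x i)
    (hy : ∀ i, 0 ≤ y i) (hxy : x ≠ y) {a c : ℝ} (ha : 0 < a) (hc : 0 < c) (hac : a + c = 1) :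
    a * entropy x + c * entropy y < entropy (a • x + c • y) := by
  obtain ⟨i, hi⟩ := Function.ne_iff.1 hxy
  rw [entropy, entropy, entropy, Finset.mul_sum, Finset.mul_sum, ← Finset.sum_add_distrib]
  exact Finset.sum_lt_sum
    (fun i _ => Real.concaveOn_negMulLog.2 (hx i) (hy i) ha.le hc.le hac)
    ⟨i, Finset.mem_univ i, Real.strictConcaveOn_negMulLog.2 (hx i) (hy i) hi ha hc hac⟩

namespace Problem

variable {V A R S X : Type*} {Y : V → Type*}
  [Fintype V] [DecidableEq V] [Fintype A] [Fintype R] [DecidableEq R] [Fintype S]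
  [∀ v, Fintype (Y v)] [∀ v, DecidableEq (Y v)]
  {M : Problem V A R S X Y}

/-! ### The dual program -/

theorem convex_dualFeasible : Convex ℝ M.dualFeasible := by
  intro b hb b' hb' a c ha hc hac
  refine ⟨fun s v => convex_stdSimplex ℝ _ (hb.1 s v) (hb'.1 s v) ha hc hac,
    fun s α => convex_stdSimplex ℝ _ (hb.2.1 s α) (hb'.2.1 s α) ha hc hac, fun s α v z => ?_⟩
  simp only [Prod.snd_add, Prod.smul_snd, Prod.fst_add, Prod.smul_fst, Pi.add_apply, Pi.smul_apply,
    smul_eq_mul, Finset.sum_add_distrib, ← Finset.mul_sum]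
  rw [hb.2.2 s α v z, hb'.2.2 s α v z]

theorem moment_combo (b b' : M.Beliefs) (a c : ℝ) (r : R) :
    M.moment (a • b + c • b') r = a * M.moment b r + c * M.moment b' r := by
  simp only [moment, Prod.snd_add, Prod.smul_snd, Prod.fst_add, Prod.smul_fst, Pi.add_apply,
    Pi.smul_apply, smul_eq_mul, Finset.mul_sum, ← Finset.sum_add_distrib, mul_add, add_mul,
    mul_assoc]
  refine Finset.sum_congr rfl fun s _ => ?_
  simp only [Finset.sum_add_distrib]
  ring

/-- The moment penalty is convex and the prior term linear. Strictness comes from the entropies: all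
carry positive weight, and distinct families differ at some node or some factor. -/
theorem PosTemp.strictConcaveOn_dualObjective (hM : M.PosTemp) {q : ℝ}
    (hpq : M.p.HolderConjugate q) (hC : 0 < M.C) :
    StrictConcaveOn ℝ M.dualFeasible (M.dualObjective q) := by
  refine ⟨convex_dualFeasible, fun b hb b' hb' hne a c ha hc hac => ?_⟩
  have hq := hpq.symm.pos
  have hmom : ∑ r, |M.moment (a • b + c • b') r - M.empirical r| ^ q
      ≤ a * ∑ r, |M.moment b r - M.empirical r| ^ q
        + c * ∑ r, |M.moment b' r - M.empirical r| ^ q := by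
    rw [Finset.mul_sum, Finset.mul_sum, ← Finset.sum_add_distrib]
    refine Finset.sum_le_sum fun r _ => ?_
    have h := (strictConvexOn_abs_rpow hpq.symm.lt).convexOn.2
      (Set.mem_univ (M.moment b r - M.empirical r)) (Set.mem_univ (M.moment b' r - M.empirical r))
      ha.le hc.le hac
    simp only [smul_eq_mul] at h
    have e : M.moment (a • b + c • b') r - M.empirical r
        = a * (M.moment b r - M.empirical r) + c * (M.moment b' r - M.empirical r) := by
      rw [moment_combo]
      linear_combination (M.empirical r) * hac
    rwa [e]
  have hV : ∀ s v, a * (M.eps * M.cV v * entropy (b.1 s v))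
      + c * (M.eps * M.cV v * entropy (b'.1 s v))
      ≤ M.eps * M.cV v * entropy (a • b.1 s v + c • b'.1 s v) := fun s v => by
    have := mul_le_mul_of_nonneg_left
      (le_entropy_combo (hb.1 s v).1 (hb'.1 s v).1 ha.le hc.le hac) (hM.1 v).le
    linarith
  have hA : ∀ s α, a * (M.eps * M.cA α * entropy (b.2 s α))
      + c * (M.eps * M.cA α * entropy (b'.2 s α))
      ≤ M.eps * M.cA α * entropy (a • b.2 s α + c • b'.2 s α) := fun s α => by
    have := mul_le_mul_of_nonneg_left
      (le_entropy_combo (hb.2.1 s α).1 (hb'.2.1 s α).1 ha.le hc.le hac) (hM.2 α).le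
    linarith
  have hsum : a * (∑ s, ∑ v, M.eps * M.cV v * entropy (b.1 s v)
        + ∑ s, ∑ α, M.eps * M.cA α * entropy (b.2 s α))
      + c * (∑ s, ∑ v, M.eps * M.cV v * entropy (b'.1 s v)
        + ∑ s, ∑ α, M.eps * M.cA α * entropy (b'.2 s α))
      < ∑ s, ∑ v, M.eps * M.cV v * entropy (a • b.1 s v + c • b'.1 s v)
        + ∑ s, ∑ α, M.eps * M.cA α * entropy (a • b.2 s α + c • b'.2 s α) := by
    have hV' : ∀ s, ∑ v, (a * (M.eps * M.cV v * entropy (b.1 s v))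
        + c * (M.eps * M.cV v * entropy (b'.1 s v)))
        ≤ ∑ v, M.eps * M.cV v * entropy (a • b.1 s v + c • b'.1 s v) := fun s =>
      Finset.sum_le_sum fun v _ => hV s v
    have hA' : ∀ s, ∑ α, (a * (M.eps * M.cA α * entropy (b.2 s α))
        + c * (M.eps * M.cA α * entropy (b'.2 s α)))
        ≤ ∑ α, M.eps * M.cA α * entropy (a • b.2 s α + c • b'.2 s α) := fun s =>
      Finset.sum_le_sum fun α _ => hA s α
    have e : ∀ (f g : S → V → ℝ) (f' g' : S → A → ℝ),
        a * (∑ s, ∑ v, f s v + ∑ s, ∑ α, f' s α) + c * (∑ s, ∑ v, g s v + ∑ s, ∑ α, g' s α)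
        = ∑ s, ∑ v, (a * f s v + c * g s v) + ∑ s, ∑ α, (a * f' s α + c * g' s α) := by
      intro f g f' g'
      simp only [Finset.sum_add_distrib, ← Finset.mul_sum]
      ring
    rw [e]
    by_cases h1 : b.1 = b'.1
    · have h2 : b.2 ≠ b'.2 := fun h2 => hne (Prod.ext h1 h2)
      obtain ⟨s, hs⟩ := Function.ne_iff.1 h2
      obtain ⟨α, hα⟩ := Function.ne_iff.1 hs
      refine add_lt_add_of_le_of_lt (Finset.sum_le_sum fun s _ => hV' s)
        (Finset.sum_lt_sum (fun s _ => hA' s) ⟨s, Finset.mem_univ s,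
          Finset.sum_lt_sum (fun α _ => hA s α) ⟨α, Finset.mem_univ α, ?_⟩⟩)
      have := mul_lt_mul_of_pos_left
        (lt_entropy_combo (hb.2.1 s α).1 (hb'.2.1 s α).1 hα ha hc hac) (hM.2 α)
      linarith
    · obtain ⟨s, hs⟩ := Function.ne_iff.1 h1
      obtain ⟨v, hv⟩ := Function.ne_iff.1 hs
      refine add_lt_add_of_lt_of_le (Finset.sum_lt_sum (fun s _ => hV' s) ⟨s, Finset.mem_univ s,
          Finset.sum_lt_sum (fun α _ => hV s α) ⟨v, Finset.mem_univ v, ?_⟩⟩)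
        (Finset.sum_le_sum fun s _ => hA' s)
      have := mul_lt_mul_of_pos_left
        (lt_entropy_combo (hb.1 s v).1 (hb'.1 s v).1 hv ha hc hac) (hM.1 v)
      linarith
  have hlin : ∑ s, ∑ v, ∑ z, (a • b + c • b').1 s v z * M.err (M.label s) v z
      = a * ∑ s, ∑ v, ∑ z, b.1 s v z * M.err (M.label s) v z
        + c * ∑ s, ∑ v, ∑ z, b'.1 s v z * M.err (M.label s) v z := by
    simp only [Prod.fst_add, Prod.smul_fst, Pi.add_apply, Pi.smul_apply, smul_eq_mul,
      Finset.mul_sum, ← Finset.sum_add_distrib, add_mul, mul_assoc]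
  have hmom' := mul_le_mul_of_nonneg_left hmom
    (show 0 ≤ M.C ^ (1 - q) / q from div_nonneg (Real.rpow_nonneg hC.le _) hq.le)
  simp only [dualObjective, Finset.sum_add_distrib, smul_eq_mul, hlin]
  change _ < ∑ s, ∑ α, M.eps * M.cA α * entropy (a • b.2 s α + c • b'.2 s α)
      + ∑ s, ∑ v, M.eps * M.cV v * entropy (a • b.1 s v + c • b'.1 s v) + _ - _
  linarith

variable [∀ v, Nonempty (Y v)]

/-- Strong duality: at a minimizer of the objective the beliefs solve the dual program. -/
theorem PosTemp.isDualSolution_gibbs (hM : M.PosTemp) {q : ℝ}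
    (hpq : M.p.HolderConjugate q) (hC : 0 < M.C) {lam : M.Messages} {θ : R → ℝ}
    (hslack : ∀ s α u z, M.slack (gibbs lam θ) s α u z = 0)
    (hgrad : ∀ r, M.grad θ (gibbs lam θ) r = 0) : M.IsDualSolution q (gibbs lam θ) := by
  have hb := hM.isBeliefs_gibbs lam θ
  have hfeas : gibbs lam θ ∈ M.dualFeasible :=
    ⟨hb.inSimplex.1, hb.inSimplex.2, fun s α u z => sub_eq_zero.1 (hslack s α u z)⟩
  -- Gap and slack vanish, and a vanishing gradient is exactly the condition of `neg_conj_eq` for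
  -- each feature.
  have heq : M.objective lam θ = M.dualObjective q (gibbs lam θ) := by
    rw [M.objective_eq lam θ (gibbs lam θ), hb.totalGap_eq_zero, slackPairing_eq_zero hfeas,
      dualObjective, ← entropyPart, Finset.mul_sum, zero_add, add_zero, sub_eq_add_neg,
      ← Finset.sum_neg_distrib]
    congr 1
    refine Finset.sum_congr rfl fun r _ => (neg_conj_eq hpq hC ?_).symm
    rw [← hgrad r, grad, dpow, mul_assoc]
  refine ⟨hfeas, fun b' hb' => ?_⟩
  have h1 := dualObjective_add_totalGap_le hpq hC hb' lam θ
  have h2 := hM.totalGap_nonneg ⟨hb'.1, hb'.2.1⟩ lam θ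
  linarith

theorem PosTemp.isDualSolution_unique (hM : M.PosTemp) {q : ℝ}
    (hpq : M.p.HolderConjugate q) (hC : 0 < M.C) {b b' : M.Beliefs} (hb : M.IsDualSolution q b)
    (hb' : M.IsDualSolution q b') : b' = b :=
  (hM.strictConcaveOn_dualObjective hpq hC).eq_of_isMaxOn hb'.2 hb.2 hb'.1 hb.1

/-! ### Distances of beliefs -/

/-- The distance of `b` and `b'` is controlled by the gap `g`. -/
def GapClose (b b' : M.Beliefs) (g : ℝ) : Prop :=
  (∀ s v z, (b.1 s v z - b'.1 s v z) ^ 2 ≤ 4 / (M.eps * M.cV v) * g) ∧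
    ∀ s α z, (b.2 s α z - b'.2 s α z) ^ 2 ≤ 4 / (M.eps * M.cA α) * g

theorem GapClose.symm {b b' : M.Beliefs} {g : ℝ} (h : GapClose b b' g) : GapClose b' b g :=
  ⟨fun s v z => by rw [← neg_sub, neg_sq]; exact h.1 s v z,
    fun s α z => by rw [← neg_sub, neg_sq]; exact h.2 s α z⟩

theorem GapClose.mono (hM : M.PosTemp) {b b' : M.Beliefs} {g g' : ℝ} (h : GapClose b b' g)
    (hg : g ≤ g') : GapClose b b' g' :=
  ⟨fun s v z => (h.1 s v z).trans
      (mul_le_mul_of_nonneg_left hg (div_nonneg zero_le_four (hM.1 v).le)),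
    fun s α z => (h.2 s α z).trans
      (mul_le_mul_of_nonneg_left hg (div_nonneg zero_le_four (hM.2 α).le))⟩

theorem PosTemp.gapClose (hM : M.PosTemp) {lam : M.Messages} {θ : R → ℝ} {b b' : M.Beliefs}
    (hb : InSimplex b) (hb' : M.IsBeliefs lam θ b') : GapClose b b' (M.totalGap lam θ b) :=
  ⟨fun s v z => (sq_sub_le_gap (hM.1 v) (hb.1 s v) (hb'.1 s v) z).trans
      (mul_le_mul_of_nonneg_left (gapV_le_totalGap (fun v => (hM.1 v).le) (fun α => (hM.2 α).le)
        hb lam θ s v) (div_nonneg zero_le_four (hM.1 v).le)),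
    fun s α z => (sq_sub_le_gap (hM.2 α) (hb.2 s α) (hb'.2 s α) z).trans
      (mul_le_mul_of_nonneg_left (gapA_le_totalGap (fun v => (hM.1 v).le) (fun α => (hM.2 α).le)
        hb lam θ s α) (div_nonneg zero_le_four (hM.2 α).le))⟩

theorem tendsto_zero_of_sq_le {u g : ℕ → ℝ} {c : ℝ} (hg : Tendsto g atTop (𝓝 0))
    (h : ∀ t, u t ^ 2 ≤ c * g t) : Tendsto u atTop (𝓝 0) := by
  have h1 : Tendsto (fun t => u t ^ 2) atTop (𝓝 0) :=
    squeeze_zero (fun t => sq_nonneg _) h (by simpa using hg.const_mul c)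
  have h2 := (Real.continuous_sqrt.tendsto 0).comp h1
  rw [Real.sqrt_zero] at h2
  refine (tendsto_zero_iff_abs_tendsto_zero u).2 (h2.congr fun t => ?_)
  simp [Real.sqrt_sq_eq_abs]

theorem tendsto_sub_of_gapClose {b b' : ℕ → M.Beliefs} {g : ℕ → ℝ}
    (hg : Tendsto g atTop (𝓝 0)) (h : ∀ t, GapClose (b t) (b' t) (g t)) :
    Tendsto (fun t => b t - b' t) atTop (𝓝 0) := by
  refine Prod.tendsto_iff _ _ |>.2 ⟨?_, ?_⟩
  · exact tendsto_pi_nhds.2 fun s => tendsto_pi_nhds.2 fun v => tendsto_pi_nhds.2 fun z =>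
      tendsto_zero_of_sq_le hg fun t => (h t).1 s v z
  · exact tendsto_pi_nhds.2 fun s => tendsto_pi_nhds.2 fun v => tendsto_pi_nhds.2 fun z =>
      tendsto_zero_of_sq_le hg fun t => (h t).2 s v z

theorem moment_sub (b b' : M.Beliefs) (r : R) :
    M.moment (b - b') r = M.moment b r - M.moment b' r := by
  have := moment_combo b b' 1 (-1) r
  rw [one_smul, neg_one_smul, ← sub_eq_add_neg] at this
  linarith

theorem slack_sub (b b' : M.Beliefs) (s : S) (α : A) (u : {v // v ∈ M.scope α}) (z : Y u) :
    M.slack (b - b') s α u z = M.slack b s α u z - M.slack b' s α u z := by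
  simp only [slack, Prod.fst_sub, Prod.snd_sub, Pi.sub_apply, Finset.sum_sub_distrib]
  ring

theorem tendsto_moment_sub {b b' : ℕ → M.Beliefs}
    (h : Tendsto (fun t => b t - b' t) atTop (𝓝 0)) (r : R) :
    Tendsto (fun t => M.moment (b t) r - M.moment (b' t) r) atTop (𝓝 0) := by
  have := ((continuous_moment (M := M) r).tendsto 0).comp h
  have h0 : M.moment (0 : M.Beliefs) r = 0 := by simp [moment]
  rw [h0] at this
  exact this.congr fun t => moment_sub _ _ _

theorem tendsto_slack_sub {b b' : ℕ → M.Beliefs}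
    (h : Tendsto (fun t => b t - b' t) atTop (𝓝 0)) (s : S) (α : A) (u : {v // v ∈ M.scope α})
    (z : Y u) :
    Tendsto (fun t => M.slack (b t) s α u z - M.slack (b' t) s α u z) atTop (𝓝 0) := by
  have := ((continuous_slack (M := M) s α u z).tendsto 0).comp h
  have h0 : M.slack (0 : M.Beliefs) s α u z = 0 := by simp [slack]
  rw [h0] at this
  exact this.congr fun t => slack_sub _ _ _ _ _ _

/-- For `p < 2` the derivative is not Lipschitz at `0`, so uniform continuity on a compact interval
is used instead. -/
theorem tendsto_dpow_sub {p : ℝ} (hp : 1 < p) {x y : ℕ → ℝ} {B : ℝ} (hx : ∀ t, |x t| ≤ B)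
    (h : Tendsto (fun t => y t - x t) atTop (𝓝 0)) :
    Tendsto (fun t => dpow p (y t) - dpow p (x t)) atTop (𝓝 0) := by
  have hu : UniformContinuousOn (dpow p) (Set.Icc (-(B + 1)) (B + 1)) :=
    isCompact_Icc.uniformContinuousOn_of_continuous (continuous_dpow hp).continuousOn
  rw [Metric.tendsto_nhds]
  intro ε hε
  obtain ⟨δ, hδ, hδ'⟩ := Metric.uniformContinuousOn_iff.1 hu ε hε
  filter_upwards [Metric.tendsto_nhds.1 h (min δ 1) (lt_min hδ one_pos)] with t ht
  rw [Real.dist_eq, sub_zero] at ht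
  have h1 := ht.trans_le (min_le_left _ _)
  have h2 := abs_lt.1 (ht.trans_le (min_le_right _ _))
  have h3 := abs_le.1 (hx t)
  have := hδ' (y t) ⟨by linarith, by linarith⟩ (x t) ⟨by linarith, by linarith⟩ h1
  rw [Real.dist_eq] at this ⊢
  rwa [sub_zero]

theorem grad_eq (θ : R → ℝ) (b : M.Beliefs) (r : R) :
    M.grad θ b r = M.moment b r - M.empirical r + M.C * dpow M.p (θ r) := by
  rw [grad, dpow, mul_assoc]

theorem tendsto_grad_sub (hp : 1 < M.p) {b b' : ℕ → M.Beliefs} {θ θ' : ℕ → R → ℝ} {r : R} {B : ℝ}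
    (h : Tendsto (fun t => b' t - b t) atTop (𝓝 0)) (hθ : ∀ t, |θ t r| ≤ B)
    (h' : Tendsto (fun t => θ' t r - θ t r) atTop (𝓝 0)) :
    Tendsto (fun t => M.grad (θ' t) (b' t) r - M.grad (θ t) (b t) r) atTop (𝓝 0) := by
  have h1 := (tendsto_moment_sub h r).add ((tendsto_dpow_sub hp hθ h').const_mul M.C)
  rw [mul_zero, add_zero] at h1
  refine h1.congr fun t => ?_
  rw [grad_eq, grad_eq]
  ring

theorem sum_update_sub_mul (θ : R → ℝ) (r : R) (y : ℝ) (g : R → ℝ) :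
    ∑ r', (Function.update θ r y r' - θ r') * g r' = (y - θ r) * g r := by
  rw [Fintype.sum_eq_single r]
  · simp
  · intro r' hr'
    simp [Function.update_of_ne hr']

theorem abs_mul_le_of_mem_stdSimplex {ι : Type*} [Fintype ι] {b : ι → ℝ} (hb : b ∈ stdSimplex ℝ ι)
    (f : ι → ℝ) : |∑ i, b i * f i| ≤ ∑ i, |f i| := by
  refine (Finset.abs_sum_le_sum_abs _ _).trans (Finset.sum_le_sum fun i _ => ?_)
  rw [abs_mul, abs_of_nonneg (hb.1 i)]
  refine mul_le_of_le_one_left (abs_nonneg _) ?_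
  rw [← hb.2]
  exact Finset.single_le_sum (fun j _ => hb.1 j) (Finset.mem_univ i)

theorem exists_abs_moment_le (r : R) :
    ∃ K, ∀ b : M.Beliefs, InSimplex b → |M.moment b r| ≤ K := by
  refine ⟨∑ s, (∑ v ∈ M.nodes r (M.input s), ∑ z, |M.phiV r v (M.input s) z|
    + ∑ α ∈ M.factors r (M.input s), ∑ z, |M.phiA r α (M.input s) z|), fun b hb => ?_⟩
  refine (Finset.abs_sum_le_sum_abs _ _).trans (Finset.sum_le_sum fun s _ =>
    (abs_add_le _ _).trans (add_le_add ?_ ?_))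
  · exact (Finset.abs_sum_le_sum_abs _ _).trans
      (Finset.sum_le_sum fun v _ => abs_mul_le_of_mem_stdSimplex (hb.1 s v) _)
  · exact (Finset.abs_sum_le_sum_abs _ _).trans
      (Finset.sum_le_sum fun v _ => abs_mul_le_of_mem_stdSimplex (hb.2 s v) _)

theorem exists_abs_grad_le (hp : 1 < M.p) (hC : 0 < M.C) (r : R) (B : ℝ) :
    ∃ K, ∀ (θ : R → ℝ) (b : M.Beliefs), InSimplex b → |θ r| ≤ B → |M.grad θ b r| ≤ K := by
  obtain ⟨K₁, h₁⟩ := exists_abs_moment_le (M := M) r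
  obtain ⟨K₂, h₂⟩ := (isCompact_Icc (a := -B) (b := B)).exists_bound_of_continuousOn
    (continuous_dpow hp).continuousOn
  refine ⟨K₁ + |M.empirical r| + M.C * K₂, fun θ b hb hθ => ?_⟩
  rw [grad_eq]
  refine (abs_add_le _ _).trans (add_le_add ((abs_sub _ _).trans (add_le_add_left (h₁ b hb) _)) ?_)
  rw [abs_mul, abs_of_pos hC]
  exact mul_le_mul_of_nonneg_left (h₂ (θ r) (abs_le.1 hθ)) hC.le

/-- The partial derivative in `θ r` varies little when only `θ r` varies a little. -/
theorem PosTemp.tendsto_grad_update_sub (hM : M.PosTemp) (hp : 1 < M.p) (hC : 0 < M.C)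
    {lam : ℕ → M.Messages} {θ : ℕ → R → ℝ} {y : ℕ → ℝ} {r : R} {B : ℝ} (hθ : ∀ t, |θ t r| ≤ B)
    (hy : Tendsto (fun t => y t - θ t r) atTop (𝓝 0)) :
    Tendsto (fun t => M.grad (Function.update (θ t) r (y t))
        (gibbs (lam t) (Function.update (θ t) r (y t))) r
      - M.grad (θ t) (gibbs (lam t) (θ t)) r) atTop (𝓝 0) := by
  obtain ⟨D, hD⟩ : ∃ D, ∀ t, |y t - θ t r| ≤ D := by
    obtain ⟨D, hD⟩ := (Metric.isBounded_range_of_tendsto _ hy).exists_norm_le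
    exact ⟨D, fun t => hD _ ⟨t, rfl⟩⟩
  obtain ⟨K, hK⟩ := exists_abs_grad_le hp hC r (B + D)
  -- Adding the increment formula from the new point to the gradient inequality from the old one
  -- bounds the gap by the displacement times the difference of partial derivatives. The bound is
  -- uniform in `lam t`, which need not be bounded.
  have hgap : ∀ t, GapClose (gibbs (lam t) (Function.update (θ t) r (y t)))
      (gibbs (lam t) (θ t)) (2 * K * |y t - θ t r|) := by
    intro t
    set θ' := Function.update (θ t) r (y t) with hθ'
    have hb := hM.isBeliefs_gibbs (lam t) (θ t)
    have hb' := hM.isBeliefs_gibbs (lam t) θ'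
    refine (hM.gapClose hb'.inSimplex hb).mono hM ?_
    have e1 := hb'.objective_sub (lam' := lam t) (θ' := θ t)
    have e2 := hM.le_objective_sub hp hC (lam' := lam t) (θ' := θ') hb
    have e3 : ∑ r', (θ t r' - θ' r') * M.grad θ' (gibbs (lam t) θ') r'
        = -((y t - θ t r) * M.grad θ' (gibbs (lam t) θ') r) := by
      rw [← sum_update_sub_mul, ← Finset.sum_neg_distrib]
      exact Finset.sum_congr rfl fun r' _ => by rw [hθ']; ring
    have e4 : 0 ≤ ∑ r', M.C * bregman M.p (θ t r') (θ' r') :=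
      Finset.sum_nonneg fun r _ => mul_nonneg hC.le (bregman_nonneg hp _ _)
    have e5 : M.slackPairing (lam t - lam t) (gibbs (lam t) θ') = 0 := by simp [slackPairing]
    have e6 : M.slackPairing (lam t - lam t) (gibbs (lam t) (θ t)) = 0 := by simp [slackPairing]
    rw [Finset.sum_add_distrib, e3, e5] at e1
    rw [sum_update_sub_mul, e6] at e2
    have hD0 : 0 ≤ D := (abs_nonneg _).trans (hD t)
    have g1 := hK (θ t) _ hb.inSimplex ((hθ t).trans (by linarith))
    have g2 := hK θ' _ hb'.inSimplex (by
      rw [hθ', Function.update_self]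
      have h1 := abs_add_le (θ t r) (y t - θ t r)
      rw [add_sub_cancel] at h1
      have h2 := hD t
      have h3 := hθ t
      linarith)
    have g3 : (y t - θ t r) * (M.grad θ' (gibbs (lam t) θ') r - M.grad (θ t) (gibbs (lam t) (θ t)) r)
        ≤ |y t - θ t r| * (K + K) := by
      refine (le_abs_self _).trans ?_
      rw [abs_mul]
      exact mul_le_mul_of_nonneg_left ((abs_sub _ _).trans (add_le_add g2 g1)) (abs_nonneg _)
    linarith
  have h0 : Tendsto (fun t => 2 * K * |y t - θ t r|) atTop (𝓝 0) := by
    simpa using ((tendsto_zero_iff_abs_tendsto_zero _).1 hy).const_mul (2 * K)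
  exact tendsto_grad_sub hp (tendsto_sub_of_gapClose h0 hgap) hθ (by simpa using hy)

/-! ### The steps of the line search -/

/-- After an exact line search the partial derivative vanishes. -/
theorem ExactStep.grad_eq_zero (hM : M.PosTemp) (hp : 1 < M.p) (hC : 0 < M.C)
    {lam : M.Messages} {θ : R → ℝ} {r : R} {η : ℝ}
    (h : M.ExactStep lam θ (gibbs lam θ) r η) :
    M.grad (M.thetaStep θ (gibbs lam θ) r η)
      (gibbs lam (M.thetaStep θ (gibbs lam θ) r η)) r = 0 := by
  obtain ⟨hη, hmin⟩ := h
  set G := M.grad θ (gibbs lam θ) r with hG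
  set x : ℝ → R → ℝ := fun η => M.thetaStep θ (gibbs lam θ) r η with hx
  set γ : ℝ → ℝ := fun η => M.grad (x η) (gibbs lam (x η)) r with hγ
  have hx0 : x 0 = θ := by simp [hx, thetaStep]
  have hxr : ∀ η r', x η r' = θ r' - (if r' = r then η * G else 0) := fun η r' => by
    by_cases h : r' = r
    · subst h
      simp [hx, thetaStep, hG]
    · simp [hx, thetaStep, h]
  have hxc : Continuous x := by
    refine continuous_pi fun r' => ?_
    simp only [hxr]
    split_ifs <;> fun_prop
  have hγc : Continuous γ := (continuous_grad hp r).comp (f := fun η => (x η, gibbs lam (x η)))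
    (hxc.prodMk (continuous_gibbs.comp (f := fun η => (lam, x η)) (by fun_prop)))
  -- The gradient inequality from `x η'` to the minimizer `x η` fixes the sign of `G * γ` on either
  -- side of `η`; continuity then gives it at `η`.
  have key : ∀ η' ≥ 0, (η' - η) * (G * γ η') ≤ 0 := by
    intro η' hη'
    have h1 := hM.le_objective_sub hp hC (lam' := lam) (θ' := x η) (hM.isBeliefs_gibbs lam (x η'))
    have h2 := hmin η' hη'
    have h3 : ∑ r', (x η r' - x η' r') * M.grad (x η') (gibbs lam (x η')) r'
        = (η' - η) * (G * γ η') := by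
      rw [Fintype.sum_eq_single r]
      · simp only [hxr, hγ, if_true]
        ring
      · intro r' hr'
        simp [hxr, hr']
    have h4 : M.slackPairing (lam - lam) (gibbs lam (x η')) = 0 := by simp [slackPairing]
    rw [h3, h4] at h1
    simp only [hx] at h1 ⊢
    linarith
  have hle : G * γ η ≤ 0 := by
    have h1 : Tendsto (fun t => G * γ t) (𝓝[>] η) (𝓝 (G * γ η)) :=
      (continuous_const.mul hγc).continuousAt.tendsto.mono_left nhdsWithin_le_nhds
    refine le_of_tendsto h1 (eventually_nhdsWithin_of_forall fun t ht => ?_)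
    have ht' : 0 < t - η := sub_pos.2 ht
    have := key t (by linarith)
    exact nonpos_of_mul_nonpos_right this ht'
  have hγ0 : γ 0 = G := by simp only [hγ, hx0, hG]
  by_cases hG0 : G = 0
  · have : x η = θ := by
      funext r'
      simp [hxr, hG0]
    change γ η = 0
    rw [hγ]
    simp only [this]
    exact hG0
  · rcases hη.eq_or_lt with h0 | h0
    -- At the boundary `η = 0` only the right-hand sign is available, but there `γ 0 = G`, so `G * G
    -- ≤ 0`.
    · rw [← h0, hγ0] at hle
      exact absurd (mul_self_eq_zero.1 (le_antisymm hle (mul_self_nonneg G))) hG0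
    · have hge : 0 ≤ G * γ η := by
        have h1 : Tendsto (fun t => G * γ t) (𝓝[<] η) (𝓝 (G * γ η)) :=
          (continuous_const.mul hγc).continuousAt.tendsto.mono_left nhdsWithin_le_nhds
        refine ge_of_tendsto h1 ?_
        filter_upwards [self_mem_nhdsWithin, (eventually_gt_nhds h0).filter_mono
          nhdsWithin_le_nhds] with t ht ht0
        have ht' : t - η < 0 := sub_neg.2 ht
        have := key t ht0.le
        by_contra hneg
        have := mul_pos_of_neg_of_neg ht' (not_le.1 hneg)
        linarith
      exact (mul_eq_zero.1 (le_antisymm hle hge)).resolve_left hG0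

/-- If a step size violates the sufficient decrease condition, the partial derivative changes by
a fixed fraction. -/
theorem PosTemp.le_abs_grad_sub (hM : M.PosTemp) (hp : 1 < M.p) (hC : 0 < M.C) {σ η : ℝ}
    (hη : 0 < η) {lam : M.Messages} {θ : R → ℝ} {r : R}
    (h : ¬ M.SufficientDecrease σ lam θ (gibbs lam θ) r η) :
    (1 - σ) * |M.grad θ (gibbs lam θ) r| ≤ |M.grad (M.thetaStep θ (gibbs lam θ) r η)
      (gibbs lam (M.thetaStep θ (gibbs lam θ) r η)) r - M.grad θ (gibbs lam θ) r| := by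
  set G := M.grad θ (gibbs lam θ) r with hG
  set x := M.thetaStep θ (gibbs lam θ) r η with hx
  set γ := M.grad x (gibbs lam x) r with hγ
  have h1 := hM.le_objective_sub hp hC (lam' := lam) (θ' := θ) (hM.isBeliefs_gibbs lam x)
  have h3 : ∑ r', (θ r' - x r') * M.grad x (gibbs lam x) r' = η * G * γ := by
    rw [Fintype.sum_eq_single r]
    · simp [hx, thetaStep, hG, hγ]
    · intro r' hr'
      simp [hx, thetaStep, hr']
  have h4 : M.slackPairing (lam - lam) (gibbs lam x) = 0 := by simp [slackPairing]
  rw [h3, h4, add_zero] at h1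
  rw [SufficientDecrease, not_le] at h
  -- The gradient inequality bounds the decrease below by `η * G * γ`, while the violated condition
  -- bounds it above by `σ * η * G ^ 2`.
  have h5 : η * (G * γ) < η * (σ * G ^ 2) := by
    linarith
  have h6 := lt_of_mul_lt_mul_left h5 hη.le
  have h7 : G * (G - γ) ≤ |G| * |γ - G| := by
    rw [← abs_neg (γ - G), neg_sub, ← abs_mul]
    exact le_abs_self _
  rcases (abs_nonneg G).eq_or_lt with h0 | h0
  · rw [← h0, mul_zero]
    exact abs_nonneg _
  · refine le_of_mul_le_mul_left ?_ h0
    have h8 : |G| * ((1 - σ) * |G|) = (1 - σ) * (G * G) := by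
      rw [← abs_mul_abs_self G]
      ring
    rw [h8]
    linarith

/-! ### Convergence -/

/-- Two points are close as measured by `g`, one of them seen from the other. -/
def StepClose (lam lam' : M.Messages) (θ θ' : R → ℝ) (g : ℝ) : Prop :=
  M.totalGap lam' θ' (gibbs lam θ) ≤ g ∧ ∀ r, M.C * bregman M.p (θ' r) (θ r) ≤ g

/-- The excess of the objective over its linearization is exactly the total gap plus the Bregman
terms. All are nonnegative, so each is at most the excess. -/
theorem PosTemp.stepClose (hM : M.PosTemp) (hp : 1 < M.p) (hC : 0 < M.C)
    {lam lam' : M.Messages} {θ θ' : R → ℝ} {g : ℝ}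
    (h : M.objective lam' θ' - M.objective lam θ - ∑ r, (θ' r - θ r) * M.grad θ (gibbs lam θ) r
      - M.slackPairing (lam' - lam) (gibbs lam θ) ≤ g) : StepClose lam lam' θ θ' g := by
  have hb := hM.isBeliefs_gibbs lam θ
  have h1 := hM.totalGap_nonneg hb.inSimplex lam' θ'
  have h2 : ∀ r, 0 ≤ M.C * bregman M.p (θ' r) (θ r) := fun r =>
    mul_nonneg hC.le (bregman_nonneg hp _ _)
  rw [hb.objective_sub, Finset.sum_add_distrib] at h
  refine ⟨?_, fun r => ?_⟩
  · have := Finset.sum_nonneg fun r (_ : r ∈ Finset.univ) => h2 r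
    linarith
  · have := Finset.single_le_sum (fun r _ => h2 r) (Finset.mem_univ r)
    linarith

/-! ### Asymptotics of a run. -/

section Run

variable {sched : ℕ → V ⊕ R} {lam : ℕ → M.Messages} {θ : ℕ → R → ℝ} {η : ℕ → ℝ} {b : ℕ → M.Beliefs}

theorem IsRun.eq_gibbs (hM : M.PosTemp) (hrun : M.IsRun sched lam θ η b) (t : ℕ) :
    b t = gibbs (lam t) (θ t) := hM.isBeliefs_iff.1 (hrun.beliefs t)

/-- At positive temperatures beliefs are unique, so the consistent beliefs provided by the message
update are those of the run. -/
theorem IsRun.slack_eq_zero (heps : 0 ≤ M.eps) (hcA : ∀ α, 0 ≤ M.cA α) (hcV : ∀ v, 0 ≤ M.cV v)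
    (hM : M.PosTemp) (hrun : M.IsRun sched lam θ η b) {t : ℕ} {v : V} (hv : sched t = Sum.inl v)
    (s : S) (α : M.Nbr v) (z : Y v) : M.slack (b (t + 1)) s α.1 ⟨v, α.2⟩ z = 0 := by
  obtain ⟨hu, hθ⟩ := hrun.message_step t v hv
  obtain ⟨b', hbel, hb'⟩ := hu.exists_isBeliefs heps hcA hcV
  have : b (t + 1) = b' := by
    rw [hrun.eq_gibbs hM, hM.isBeliefs_iff.1 hbel, hθ]
  rw [this, hb']

/-- In each step, the distance travelled is controlled by the decrease of the objective. -/
theorem IsRun.stepClose (heps : 0 ≤ M.eps) (hcA : ∀ α, 0 ≤ M.cA α) (hcV : ∀ v, 0 ≤ M.cV v)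
    (hM : M.PosTemp) (hp : 1 < M.p) (hC : 0 < M.C) (hrun : M.IsRun sched lam θ η b)
    {σ β η₀ : ℝ} (hσ : 0 < σ) (hσ' : σ < 1)
    (hls : ∀ t r, sched t = Sum.inr r → M.ExactStep (lam t) (θ t) (b t) r (η t) ∨
      M.ArmijoStep σ β η₀ (lam t) (θ t) (b t) r (η t)) (t : ℕ) :
    let g := (M.objective (lam t) (θ t) - M.objective (lam (t + 1)) (θ (t + 1))) / σ
    StepClose (lam (t + 1)) (lam t) (θ (t + 1)) (θ t) g ∨
      StepClose (lam t) (lam (t + 1)) (θ t) (θ (t + 1)) g := by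
  intro g
  set d := M.objective (lam t) (θ t) - M.objective (lam (t + 1)) (θ (t + 1))
  have hdnn : 0 ≤ d := sub_nonneg.2 (hrun.antitone heps hcA hcV (Nat.le_succ t))
  have hdg : d ≤ g := by
    rw [le_div_iff₀ hσ]
    exact mul_le_of_le_one_right hdnn hσ'.le
  rcases h : sched t with v | r
  -- After a message update, as after an exact line search, the linear term seen from the new point
  -- vanishes, so the excess is the decrease itself.
  · left
    obtain ⟨hu, hθ⟩ := hrun.message_step t v h
    refine hM.stepClose hp hC ?_
    have h1 : M.slackPairing (lam t - lam (t + 1)) (gibbs (lam (t + 1)) (θ (t + 1))) = 0 :=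
      hu.slackPairing_eq_zero fun s α z => by
        rw [← hrun.eq_gibbs hM (t + 1), hrun.slack_eq_zero heps hcA hcV hM h]
    have h2 : ∑ r, (θ t r - θ (t + 1) r)
        * M.grad (θ (t + 1)) (gibbs (lam (t + 1)) (θ (t + 1))) r = 0 := by
      simp [hθ]
    rw [h1, h2]
    linarith
  · obtain ⟨hlam, hη, hθ, -⟩ := hrun.theta_step t r h
    rcases hls t r h with hex | har
    · left
      refine hM.stepClose hp hC ?_
      rw [hrun.eq_gibbs hM t] at hex hθ
      have h0 := hex.grad_eq_zero hM hp hC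
      rw [← hθ] at h0
      have h1 : M.slackPairing (lam t - lam (t + 1)) (gibbs (lam (t + 1)) (θ (t + 1))) = 0 := by
        simp [hlam, slackPairing]
      have h2 : ∑ r', (θ t r' - θ (t + 1) r')
          * M.grad (θ (t + 1)) (gibbs (lam (t + 1)) (θ (t + 1))) r' = 0 := by
        refine Finset.sum_eq_zero fun r' _ => ?_
        by_cases hr : r' = r
        · rw [hr, hlam, h0, mul_zero]
        · rw [hθ, thetaStep, Function.update_of_ne hr, sub_self, zero_mul]
      rw [h1, h2]
      linarith
    -- Seen from the old point the linear term is `-η G²`, and sufficient decrease bounds `η G²` by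
    -- the decrease divided by `σ`. This is why `g` carries the factor `1 / σ`.
    · right
      refine hM.stepClose hp hC ?_
      obtain ⟨-, hsd, -⟩ := har
      rw [hrun.eq_gibbs hM t] at hsd hθ
      rw [SufficientDecrease, ← hθ] at hsd
      have h1 : M.slackPairing (lam (t + 1) - lam t) (gibbs (lam t) (θ t)) = 0 := by
        simp [hlam, slackPairing]
      have h2 : ∑ r', (θ (t + 1) r' - θ t r') * M.grad (θ t) (gibbs (lam t) (θ t)) r'
          = -(η t * M.grad (θ t) (gibbs (lam t) (θ t)) r ^ 2) := by
        rw [hθ, thetaStep, sum_update_sub_mul]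
        ring
      have h3 : η t * M.grad (θ t) (gibbs (lam t) (θ t)) r ^ 2 ≤ g := by
        rw [le_div_iff₀ hσ, hlam]
        linarith
      rw [h1, h2]
      linarith

variable {q : ℝ}

/-- The messages of a run may be unbounded, because the constants `k` in the updates are arbitrary;
only representatives with the same objective and beliefs are bounded. -/
theorem IsRun.exists_bound (hpq : M.p.HolderConjugate q) (hC : 0 < M.C)
    (heps : 0 ≤ M.eps) (hcA : ∀ α, 0 ≤ M.cA α) (hcV : ∀ v, 0 ≤ M.cV v)
    (hM : M.PosTemp) (hrun : M.IsRun sched lam θ η b) :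
    ∃ B : ℝ, (∀ t r, |θ t r| ≤ B) ∧ ∀ t, ∃ lam' : M.Messages, ‖lam'‖ ≤ B ∧
      M.objective lam' (θ t) = M.objective (lam t) (θ t) ∧ M.IsBeliefs lam' (θ t) (b t) := by
  obtain ⟨B, hB⟩ := hM.exists_normalization hpq hC (M.objective (lam 0) (θ 0))
  have h := fun t => hB (lam t) (θ t) (hrun.antitone heps hcA hcV (Nat.zero_le t))
  refine ⟨B, fun t r => ?_, fun t => ?_⟩
  · exact (Finset.single_le_sum (f := fun r => |θ t r|) (fun _ _ => abs_nonneg _)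
      (Finset.mem_univ r)).trans (h t).1
  · obtain ⟨-, lam', h1, h2, h3⟩ := h t
    exact ⟨lam', h1, h2, h3 _ (hrun.beliefs t)⟩

/-- The increments of the beliefs and of the parameters tend to zero. -/
theorem IsRun.tendsto_increments (hpq : M.p.HolderConjugate q) (hC : 0 < M.C)
    (heps : 0 ≤ M.eps) (hcA : ∀ α, 0 ≤ M.cA α) (hcV : ∀ v, 0 ≤ M.cV v)
    (hM : M.PosTemp) (hrun : M.IsRun sched lam θ η b)
    {σ β η₀ : ℝ} (hσ : 0 < σ) (hσ' : σ < 1)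
    (hls : ∀ t r, sched t = Sum.inr r → M.ExactStep (lam t) (θ t) (b t) r (η t) ∨
      M.ArmijoStep σ β η₀ (lam t) (θ t) (b t) r (η t)) :
    Tendsto (fun t => M.objective (lam t) (θ t) - M.objective (lam (t + 1)) (θ (t + 1)))
        atTop (𝓝 0) ∧
      Tendsto (fun t => b (t + 1) - b t) atTop (𝓝 0) ∧
      ∀ r, Tendsto (fun t => θ (t + 1) r - θ t r) atTop (𝓝 0) := by
  have hp := hpq.lt
  obtain ⟨l, hl⟩ := hrun.exists_tendsto hpq hC heps hcA hcV
  have hd : Tendsto (fun t => M.objective (lam t) (θ t) - M.objective (lam (t + 1)) (θ (t + 1)))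
      atTop (𝓝 0) := by
    have := hl.sub (hl.comp (tendsto_add_atTop_nat 1))
    rwa [sub_self] at this
  set g : ℕ → ℝ := fun t =>
    (M.objective (lam t) (θ t) - M.objective (lam (t + 1)) (θ (t + 1))) / σ with hg
  have hg0 : Tendsto g atTop (𝓝 0) := by simpa using hd.div_const σ
  have hstep := hrun.stepClose heps hcA hcV hM hp hC hσ hσ' hls
  obtain ⟨B, hB, -⟩ := hrun.exists_bound hpq hC heps hcA hcV hM
  refine ⟨hd, tendsto_sub_of_gapClose hg0 fun t => ?_, fun r => ?_⟩
  · have hb : ∀ t, InSimplex (gibbs (lam t) (θ t)) := fun t =>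
      (hM.isBeliefs_gibbs (lam t) (θ t)).inSimplex
    rw [hrun.eq_gibbs hM, hrun.eq_gibbs hM]
    rcases hstep t with h | h
    · exact (hM.gapClose (hb (t + 1)) (hM.isBeliefs_gibbs _ _)).mono hM h.1
    · exact ((hM.gapClose (hb t) (hM.isBeliefs_gibbs _ _)).mono hM h.1).symm
  · rw [Metric.tendsto_nhds]
    intro ε hε
    obtain ⟨δ, hδ, hδ'⟩ := exists_bregman_lt hp B hε
    filter_upwards [hg0.eventually (gt_mem_nhds (mul_pos hC hδ))] with t ht
    rw [Real.dist_eq, sub_zero]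
    rcases hstep t with h | h
    · rw [abs_sub_comm]
      exact hδ' _ _ (hB _ _) (hB _ _) (lt_of_mul_lt_mul_left ((h.2 r).trans_lt ht) hC.le)
    · exact hδ' _ _ (hB _ _) (hB _ _) (lt_of_mul_lt_mul_left ((h.2 r).trans_lt ht) hC.le)

theorem IsRun.tendsto_slack (hpq : M.p.HolderConjugate q) (hC : 0 < M.C)
    (heps : 0 ≤ M.eps) (hcA : ∀ α, 0 ≤ M.cA α) (hcV : ∀ v, 0 ≤ M.cV v)
    (hM : M.PosTemp) (hrun : M.IsRun sched lam θ η b) (hcyc : EssentiallyCyclic sched)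
    (hls : M.LineSearch sched lam θ η b) (s : S) (α : A) (u : {v // v ∈ M.scope α}) (z : Y u) :
    Tendsto (fun t => M.slack (b t) s α u z) atTop (𝓝 0) := by
  obtain ⟨σ, β, η₀, hσ, hσ', -, -, -, hls⟩ := hls
  obtain ⟨T, hT⟩ := hcyc
  obtain ⟨-, hb, -⟩ := hrun.tendsto_increments hpq hC heps hcA hcV hM hσ hσ' hls
  have hinc := tendsto_slack_sub hb s α u z
  refine tendsto_zero_of_visits (hT (Sum.inl u.1)) (fun ε hε => ?_) hinc
  -- The slack vanishes at `t + 1` after a visit at `t`, so at `t` it equals an increment up to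
  -- sign.
  filter_upwards [Metric.tendsto_nhds.1 hinc ε hε] with t ht hv
  have := hrun.slack_eq_zero heps hcA hcV hM hv s ⟨α, u.2⟩ z
  rw [Real.dist_eq, sub_zero] at ht
  rw [show M.slack (b (t + 1)) s α u z = 0 from this, zero_sub, abs_neg] at ht
  exact ht

/-- At a visit of `r` the gradient is small for one of three reasons: it vanishes after an exact
step, a step of at least `η₀` turns it into decrease, or a nearby violating trial point changes it
by a fixed fraction. -/
theorem IsRun.tendsto_grad (hpq : M.p.HolderConjugate q) (hC : 0 < M.C)
    (heps : 0 ≤ M.eps) (hcA : ∀ α, 0 ≤ M.cA α) (hcV : ∀ v, 0 ≤ M.cV v)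
    (hM : M.PosTemp) (hrun : M.IsRun sched lam θ η b) (hcyc : EssentiallyCyclic sched)
    (hls : M.LineSearch sched lam θ η b) (r : R) :
    Tendsto (fun t => M.grad (θ t) (b t) r) atTop (𝓝 0) := by
  have hp := hpq.lt
  obtain ⟨σ, β, η₀, hσ, hσ', hβ, hβ', hη₀, hls⟩ := hls
  obtain ⟨T, hT⟩ := hcyc
  obtain ⟨hd, hb, hθ⟩ := hrun.tendsto_increments hpq hC heps hcA hcV hM hσ hσ' hls
  obtain ⟨B, hB, -⟩ := hrun.exists_bound hpq hC heps hcA hcV hM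
  have hinc := tendsto_grad_sub hp hb (fun t => hB t r) (hθ r)
  -- In the third case `y` is the coordinate of the violating trial point, otherwise it is the
  -- default `θ t r`. As `η' ≤ η / β`, its distance from `θ t r` tends to zero with the increments.
  have hy : ∀ t, ∃ y, |y - θ t r| ≤ |θ (t + 1) r - θ t r| / β ∧ (sched t = Sum.inr r →
      M.grad (θ (t + 1)) (b (t + 1)) r = 0 ∨
      σ * η₀ * M.grad (θ t) (b t) r ^ 2
        ≤ M.objective (lam t) (θ t) - M.objective (lam (t + 1)) (θ (t + 1)) ∨
      (1 - σ) * |M.grad (θ t) (b t) r| ≤ |M.grad (Function.update (θ t) r y)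
        (gibbs (lam t) (Function.update (θ t) r y)) r
        - M.grad (θ t) (gibbs (lam t) (θ t)) r|) := by
    intro t
    have htriv : |θ t r - θ t r| ≤ |θ (t + 1) r - θ t r| / β := by
      rw [sub_self, abs_zero]
      positivity
    by_cases hs : sched t = Sum.inr r
    · obtain ⟨hlam, hη, hθt, -⟩ := hrun.theta_step t r hs
      have hbt := hrun.eq_gibbs hM t
      rcases hls t r hs with hex | ⟨hpos, hsd, hbig | ⟨η', hlt, hle, hviol⟩⟩
      · refine ⟨θ t r, htriv, fun _ => Or.inl ?_⟩
        rw [hbt] at hex hθt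
        have := hex.grad_eq_zero hM hp hC
        rw [hrun.eq_gibbs hM (t + 1), hlam, hθt]
        exact this
      · refine ⟨θ t r, htriv, fun _ => Or.inr (Or.inl ?_)⟩
        rw [SufficientDecrease, ← hθt] at hsd
        rw [hlam]
        have : σ * η₀ * M.grad (θ t) (b t) r ^ 2 ≤ σ * η t * M.grad (θ t) (b t) r ^ 2 := by
          gcongr
        linarith
      · refine ⟨θ t r - η' * M.grad (θ t) (b t) r, ?_, fun _ => Or.inr (Or.inr ?_)⟩
        · rw [hθt, thetaStep, Function.update_self, sub_sub_cancel_left, sub_sub_cancel_left,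
            abs_neg, abs_neg, abs_mul, abs_mul, abs_of_pos hpos, abs_of_pos (hpos.trans hlt),
            mul_div_right_comm]
          exact mul_le_mul_of_nonneg_right hle (abs_nonneg _)
        · rw [hbt] at hviol ⊢
          exact hM.le_abs_grad_sub hp hC (hpos.trans hlt) hviol
    · exact ⟨θ t r, htriv, fun h => absurd h hs⟩
  choose y hy1 hy2 using hy
  have hy0 : Tendsto (fun t => y t - θ t r) atTop (𝓝 0) := by
    refine (tendsto_zero_iff_abs_tendsto_zero _).2 (squeeze_zero (fun t => abs_nonneg _) hy1 ?_)
    simpa using ((tendsto_zero_iff_abs_tendsto_zero _).1 (hθ r)).div_const β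
  have hgr := hM.tendsto_grad_update_sub hp hC (lam := lam) (fun t => hB t r) hy0
  refine tendsto_zero_of_visits (hT (Sum.inr r)) (fun ε hε => ?_) hinc
  have hσ1 : 0 < 1 - σ := by linarith
  filter_upwards [Metric.tendsto_nhds.1 hinc ε hε,
    Metric.tendsto_nhds.1 hgr ((1 - σ) * ε) (by positivity),
    hd.eventually (gt_mem_nhds (show 0 < σ * η₀ * ε ^ 2 by positivity))] with t h1 h2 h3 hv
  rw [Real.dist_eq, sub_zero] at h1 h2
  rcases hy2 t hv with h | h | h
  · rwa [h, zero_sub, abs_neg] at h1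
  · exact abs_lt_of_sq_lt_sq (lt_of_mul_lt_mul_left (h.trans_lt h3) (by positivity)) hε.le
  · exact lt_of_mul_lt_mul_left (h.trans_lt h2) hσ1.le

theorem abs_apply_le_norm (lam : M.Messages) (s : S) (α : A) (u : {v // v ∈ M.scope α}) (z : Y u) :
    |lam s α u z| ≤ ‖lam‖ :=
  (norm_le_pi_norm (lam s α u) z).trans ((norm_le_pi_norm (lam s α) u).trans
    ((norm_le_pi_norm (lam s) α).trans (norm_le_pi_norm lam s)))

/-- The suboptimality is squeezed between the gap of the stationary beliefs at the iterate and a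
bounded combination of the iterate's gradients and slacks; the lower bound then carries the beliefs
along. -/
theorem IsRun.tendsto_of_stationary (hpq : M.p.HolderConjugate q) (hC : 0 < M.C)
    (heps : 0 ≤ M.eps) (hcA : ∀ α, 0 ≤ M.cA α) (hcV : ∀ v, 0 ≤ M.cV v)
    (hM : M.PosTemp) (hrun : M.IsRun sched lam θ η b) (hcyc : EssentiallyCyclic sched)
    (hls : M.LineSearch sched lam θ η b) {lam₀ : M.Messages} {θ₀ : R → ℝ}
    (hslack : ∀ s α u z, M.slack (gibbs lam₀ θ₀) s α u z = 0)
    (hgrad : ∀ r, M.grad θ₀ (gibbs lam₀ θ₀) r = 0) :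
    Tendsto (fun t => M.objective (lam t) (θ t)) atTop (𝓝 (M.objective lam₀ θ₀)) ∧
      Tendsto b atTop (𝓝 (gibbs lam₀ θ₀)) := by
  have hp := hpq.lt
  obtain ⟨B, hB, hnorm⟩ := hrun.exists_bound hpq hC heps hcA hcV hM
  have hb₀ := hM.isBeliefs_gibbs lam₀ θ₀
  have hlower : ∀ t, M.totalGap (lam t) (θ t) (gibbs lam₀ θ₀)
      ≤ M.objective (lam t) (θ t) - M.objective lam₀ θ₀ := by
    intro t
    have h2 : 0 ≤ ∑ r, M.C * bregman M.p (θ t r) (θ₀ r) :=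
      Finset.sum_nonneg fun r _ => mul_nonneg hC.le (bregman_nonneg hp _ _)
    rw [hb₀.objective_sub, Finset.sum_add_distrib]
    simp only [hgrad, slackPairing, hslack, mul_zero, Finset.sum_const_zero, zero_add, add_zero]
    linarith
  have hupper : ∀ t, M.objective (lam t) (θ t) - M.objective lam₀ θ₀
      ≤ ∑ r, (B + |θ₀ r|) * |M.grad (θ t) (b t) r|
        + ∑ s, ∑ α, ∑ u, ∑ z, (B + ‖lam₀‖) * |M.slack (b t) s α u z| := by
    intro t
    -- The gradient inequality is applied at the normalized messages, so that the coefficients of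
    -- the slacks stay bounded in `t`.
    obtain ⟨lam', h1, h2, h3⟩ := hnorm t
    have h4 := hM.le_objective_sub hp hC (lam' := lam₀) (θ' := θ₀) h3
    rw [h2] at h4
    have h5 : -∑ r, (B + |θ₀ r|) * |M.grad (θ t) (b t) r|
        ≤ ∑ r, (θ₀ r - θ t r) * M.grad (θ t) (b t) r := by
      rw [← Finset.sum_neg_distrib]
      refine Finset.sum_le_sum fun r _ => (neg_le_neg ?_).trans (neg_abs_le _)
      rw [abs_mul]
      refine mul_le_mul_of_nonneg_right ((abs_sub _ _).trans ?_) (abs_nonneg _)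
      rw [add_comm]
      exact add_le_add_left (hB t r) _
    have h6 : -∑ s, ∑ α, ∑ u, ∑ z, (B + ‖lam₀‖) * |M.slack (b t) s α u z|
        ≤ M.slackPairing (lam₀ - lam') (b t) := by
      simp only [slackPairing, ← Finset.sum_neg_distrib]
      refine Finset.sum_le_sum fun s _ => Finset.sum_le_sum fun α _ => Finset.sum_le_sum fun u _ =>
        Finset.sum_le_sum fun z _ => (neg_le_neg ?_).trans (neg_abs_le _)
      rw [abs_mul]
      refine mul_le_mul_of_nonneg_right ((abs_sub _ _).trans ?_) (abs_nonneg _)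
      rw [add_comm]
      exact add_le_add ((abs_apply_le_norm _ _ _ _ _).trans h1) (abs_apply_le_norm _ _ _ _ _)
    linarith
  have hub0 : Tendsto (fun t => ∑ r, (B + |θ₀ r|) * |M.grad (θ t) (b t) r|
        + ∑ s, ∑ α, ∑ u, ∑ z, (B + ‖lam₀‖) * |M.slack (b t) s α u z|) atTop (𝓝 0) := by
    have h1 : Tendsto (fun t => ∑ r, (B + |θ₀ r|) * |M.grad (θ t) (b t) r|) atTop
        (𝓝 (∑ r : R, (B + |θ₀ r|) * 0)) :=
      tendsto_finsetSum _ fun r _ => ((tendsto_zero_iff_abs_tendsto_zero _).1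
        (hrun.tendsto_grad hpq hC heps hcA hcV hM hcyc hls r)).const_mul _
    have h2 : Tendsto (fun t => ∑ s, ∑ α, ∑ u, ∑ z, (B + ‖lam₀‖) * |M.slack (b t) s α u z|) atTop
        (𝓝 (∑ s : S, ∑ α, ∑ u : {v // v ∈ M.scope α}, ∑ z : Y u, (B + ‖lam₀‖) * 0)) :=
      tendsto_finsetSum _ fun s _ => tendsto_finsetSum _ fun α _ => tendsto_finsetSum _ fun u _ =>
        tendsto_finsetSum _ fun z _ => ((tendsto_zero_iff_abs_tendsto_zero _).1
          (hrun.tendsto_slack hpq hC heps hcA hcV hM hcyc hls s α u z)).const_mul _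
    simpa using h1.add h2
  have hsub : Tendsto (fun t => M.objective (lam t) (θ t) - M.objective lam₀ θ₀) atTop (𝓝 0) :=
    squeeze_zero (fun t => (hM.totalGap_nonneg hb₀.inSimplex _ _).trans (hlower t)) hupper hub0
  refine ⟨tendsto_sub_nhds_zero_iff.1 hsub, tendsto_sub_nhds_zero_iff.1 ?_⟩
  exact tendsto_sub_of_gapClose hsub fun t =>
    ((hM.gapClose hb₀.inSimplex (hrun.beliefs t)).mono hM (hlower t)).symm

end Run

end Problem

end StructPred

end

theorem mainTheorem5 {V A R S X : Type*} {Y : V → Type*}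
    [Fintype V] [DecidableEq V] [Fintype A] [Fintype R] [DecidableEq R] [Fintype S]
    [∀ v, Fintype (Y v)] [∀ v, DecidableEq (Y v)] [∀ v, Nonempty (Y v)]
    (M : StructPred.Problem V A R S X Y) (q : ℝ) (hpq : M.p.HolderConjugate q) (hC : 0 < M.C)
    (heps : 0 ≤ M.eps) (hcA : ∀ α, 0 ≤ M.cA α) (hcV : ∀ v, 0 ≤ M.cV v) :
    (∀ (sched : ℕ → V ⊕ R) (lam : ℕ → M.Messages) (θ : ℕ → R → ℝ) (η : ℕ → ℝ)
        (b : ℕ → M.Beliefs), M.IsRun sched lam θ η b →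
        Antitone (fun t => M.objective (lam t) (θ t)) ∧
          ∃ l : ℝ, Tendsto (fun t => M.objective (lam t) (θ t)) atTop (𝓝 l)) ∧
    (0 < M.eps → (∀ α, 0 < M.cA α) → (∀ v, 0 < M.cV v) →
      StrictConcaveOn ℝ M.dualFeasible (M.dualObjective q) ∧
      ∃ (m : ℝ) (bopt : M.Beliefs),
        IsLeast (Set.range fun x : M.Messages × (R → ℝ) => M.objective x.1 x.2) m ∧
        M.IsDualSolution q bopt ∧ (∀ b', M.IsDualSolution q b' → b' = bopt) ∧
        ∀ (sched : ℕ → V ⊕ R) (lam : ℕ → M.Messages) (θ : ℕ → R → ℝ) (η : ℕ → ℝ)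
          (b : ℕ → M.Beliefs), M.IsRun sched lam θ η b → StructPred.Problem.EssentiallyCyclic sched →
          M.LineSearch sched lam θ η b →
          Tendsto (fun t => M.objective (lam t) (θ t)) atTop (𝓝 m) ∧
            Tendsto b atTop (𝓝 bopt)) := by
  refine ⟨fun sched lam θ η b hrun => ⟨hrun.antitone heps hcA hcV,
    hrun.exists_tendsto hpq hC heps hcA hcV⟩, fun heps' hcA' hcV' => ?_⟩
  have hM : M.PosTemp := ⟨fun v => mul_pos heps' (hcV' v), fun α => mul_pos heps' (hcA' α)⟩
  refine ⟨hM.strictConcaveOn_dualObjective hpq hC, ?_⟩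
  obtain ⟨lam₀, θ₀, hmin⟩ := hM.exists_isLeast hpq hC
  obtain ⟨hslack, hgrad⟩ := hM.stationary hpq.lt hC hmin
  have hsol := hM.isDualSolution_gibbs hpq hC hslack hgrad
  refine ⟨M.objective lam₀ θ₀, StructPred.Problem.gibbs lam₀ θ₀, ⟨⟨(lam₀, θ₀), rfl⟩, ?_⟩, hsol,
    fun b' hb' => hM.isDualSolution_unique hpq hC hsol hb',
    fun sched lam θ η b hrun hcyc hls =>
      hrun.tendsto_of_stationary hpq hC heps hcA hcV hM hcyc hls hslack hgrad⟩
  rintro _ ⟨x, rfl⟩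
  exact hmin x.1 x.2
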